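/- For every $n\ge 1$ let $p=p_n$ and $m=m_n\ge 1$ be integers, let $\mathcal X=\mathcal X_n=\{1,\dots,r\}^d$ be a finite configuration space ($d=d_n$, $r=r_n$), let $\varphi:\mathcal X\to\mathbb R^p$, let $\theta^*\in\mathbb R^p$, and consider the Markov random field $$p(x\mid\theta)=e^{\theta^\top\varphi(x)}/C(\theta),\qquad C(\theta)=\sum_{x\in\mathcal X}e^{\theta^\top\varphi(x)} .$$ Let $x_1,\dots,x_n$ be i.i.d. from $p(\cdot\mid\theta^*)$. Let $Y_1,Y_2,\dots$ be a Markov chain on $\mathcal X$ with transition kernel $P$, initial distribution $q$ and strictly positive stationary distribution $h$. The Elastic-net-penalized MCMC-MLE $\widehat\theta$ is the minimizer over $\theta\in\mathbb R^p$ of $$-\frac1n\sum_{i=1}^n\theta^\top\varphi(x_i)+\log\Big(\frac1m\sum_{i=1}^m\frac{e^{\theta^\top\varphi(Y_i)}}{h(Y_i)}\Big)+\lambda_1\|\theta\|_1+\lambda_2\|\theta\|_2^2,\qquad \lambda_1,\lambda_2>0 .$$ All of these objects may depend on $n$. Let $H^*$ be the covariance matrix of $\varphi(X)$ for $X\sim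 p(\cdot\mid\theta^*)$ and $s=\|\theta^*\|_0$ the number of nonzero coordinates of $\theta^*$. For $\zeta>1$ and $T\subseteq\{1,\dots,p\}$ let $$F(\zeta,T,H^*)=\inf\Big\{\frac{|T|\,\theta^\top H^*\theta}{\|\theta_T\|_1^2}\;:\;\theta\ne0,\ \|\theta_{T^c}\|_1\le\zeta\|\theta_T\|_1\Big\}\qquad(\inf\varnothing=+\infty).$$ Assume that there are constants, independent of $n$, such that for all $n\ge1$: 1. $\max_{y\in\mathcal X}\|\varphi(y)\|_\infty\le K$ with $K>0$; 2. $\inf_{T\subseteq\{1,\dots,p\}}\inf_{\zeta>1}F(\zeta,T,H^*)\ge C_{\min}$ with $C_{\min}>0$; 3. $\|\theta^*\|_\infty\le B$ with $B>0$; 4. $P$ has operator norm at most $\kappa<1$ on the mean-zero functions in $L^2(h)$ (absolute spectral gap at least $1-\kappa$), $q\le Q\,h$ pointwise (for instance $q=h$, $Q=1$, when the chain is stationary), $\operatorname{E}_{Y\sim h}\big(p(Y\mid\theta^*)/h(Y)\big)^2\le M_1$ and $\max_y p(y\mid\theta^*)/h(y)\le M_2$; 5. $s\ge1$, and $s=O(1)$.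 Put $\rho_n=\sqrt{\frac{\log p}{n}}+\sqrt{\frac{\log p}{m}}+\frac{\log p}{m}$ and assume $\lambda_1\asymp\rho_n$, $\lambda_1\asymp\lambda_2$ and $\lambda_1=o(1)$ as $n\to\infty$. Then there is a constant $A_0>0$ that depends only on $K$, $\kappa$ and $M_1$ such that, whenever $\lambda_1\ge A_0\,\rho_n$ for all large $n$ (no such lower bound on the implied constant is needed if the sequence $(p_n)$ is bounded), $$\|\widehat\theta-\theta^*\|_1=O_p\Big(s\Big(\sqrt{\tfrac{\log p}{n}}+\sqrt{\tfrac{\log p}{m}}+\tfrac{\log p}{m}\Big)\Big)=o_p(1)\qquad(n\to\infty).$$ -/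

import Mathlib

open MeasureTheory ProbabilityTheory Filter Topology

noncomputable section

/-- Configurations of `d` vertices, each carrying one of `r` states. -/
abbrev Config (d r : ℕ) : Type := Fin d → Fin r

namespace SimMRF

/-! ### The exponential family -/

/-- The normalizing constant `C(θ) = ∑ₓ exp(θᵀ φ(x))`. -/
def normConst {d r p : ℕ} (φ : Config d r → Fin p → ℝ) (θ : Fin p → ℝ) : ℝ :=
  ∑ x, Real.exp (θ ⬝ᵥ φ x)

/-- The probability mass function `p(x ∣ θ)`. -/
def pmf {d r p : ℕ} (φ : Config d r → Fin p → ℝ) (θ : Fin p → ℝ) (x : Config d r) : ℝ :=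
  Real.exp (θ ⬝ᵥ φ x) / normConst φ θ

/-- The mean of `φ(X)` under `p(· ∣ θ)`. -/
def meanStat {d r p : ℕ} (φ : Config d r → Fin p → ℝ) (θ : Fin p → ℝ) (j : Fin p) : ℝ :=
  ∑ x, pmf φ θ x * φ x j

/-- The covariance matrix of `φ(X)` under `p(· ∣ θ)`; at the true parameter this is `H*`. -/
def covStat {d r p : ℕ} (φ : Config d r → Fin p → ℝ) (θ : Fin p → ℝ) :
    Matrix (Fin p) (Fin p) ℝ :=
  Matrix.of fun j k =>
    ∑ x, pmf φ θ x * ((φ x j - meanStat φ θ j) * (φ x k - meanStat φ θ k))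

/-! ### The Markov chain -/

/-- The action `(P f)(y) = ∑ₓ f(x) P(y, x)` of a transition kernel on functions. -/
def kernelOp {d r : ℕ} (P : Config d r → Config d r → ℝ) (f : Config d r → ℝ)
    (y : Config d r) : ℝ :=
  ∑ x, f x * P y x

/-- The norm of `L²(h)`. -/
def l2Norm {d r : ℕ} (h f : Config d r → ℝ) : ℝ :=
  Real.sqrt (∑ y, f y ^ 2 * h y)

/-- The number `κ` for which `1 - κ` is the absolute spectral gap: the operator norm of `P` on the
functions in `L²(h)` with mean zero. For a reversible chain this is the largest modulus of a
spectral value of `P` on these functions. -/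
def gapKappa {d r : ℕ} (P : Config d r → Config d r → ℝ) (h : Config d r → ℝ) : ℝ :=
  sSup {t : ℝ | ∃ f : Config d r → ℝ,
    ∑ y, f y * h y = 0 ∧ l2Norm h f ≤ 1 ∧ t = l2Norm h (kernelOp P f)}

/-- `M₁ = E_{Y ∼ h} (p(Y ∣ θ) / h(Y))²`. -/
def ratioSq {d r p : ℕ} (φ : Config d r → Fin p → ℝ) (θ : Fin p → ℝ) (h : Config d r → ℝ) : ℝ :=
  ∑ y, h y * (pmf φ θ y / h y) ^ 2

/-- `M₂ = max_y p(y ∣ θ) / h(y)`. -/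
def ratioMax {d r p : ℕ} (φ : Config d r → Fin p → ℝ) (θ : Fin p → ℝ) (h : Config d r → ℝ) : ℝ :=
  ⨆ y, pmf φ θ y / h y

/-- `Y₀, Y₁, …` is a (time-homogeneous) Markov chain with initial distribution `q` and transition
kernel `P`. -/
structure IsMarkovChain {Ω : Type*} [MeasurableSpace Ω] (μ : Measure Ω) {d r : ℕ}
    (q : Config d r → ℝ) (P : Config d r → Config d r → ℝ) (Y : ℕ → Ω → Config d r) : Prop where
  measurable : ∀ i, Measurable (Y i)
  law : ∀ (k : ℕ) (y : ℕ → Config d r),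
    μ.real {ω | ∀ i ≤ k, Y i ω = y i} = q (y 0) * ∏ i ∈ Finset.range k, P (y i) (y (i + 1))

/-- `P` is a transition kernel and `h` is a strictly positive stationary distribution of it. -/
structure IsStationaryKernel {d r : ℕ} (P : Config d r → Config d r → ℝ)
    (h : Config d r → ℝ) : Prop where
  kernel_nonneg : ∀ y x, 0 ≤ P y x
  kernel_sum : ∀ y, ∑ x, P y x = 1
  pos : ∀ y, 0 < h y
  sum_eq_one : ∑ y, h y = 1
  invariant : ∀ x, ∑ y, h y * P y x = h x

/-- `x₁, …, xₙ` are independent with common distribution `p(· ∣ θ)`. -/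
structure IsIIDSample {Ω : Type*} [MeasurableSpace Ω] (μ : Measure Ω) {d r p n : ℕ}
    (φ : Config d r → Fin p → ℝ) (θ : Fin p → ℝ) (x : Fin n → Ω → Config d r) : Prop where
  measurable : ∀ i, Measurable (x i)
  indep : iIndepFun x μ
  law : ∀ i a, μ.real {ω | x i ω = a} = pmf φ θ a

/-! ### The estimator -/

/-- The `ℓ₁`-norm. -/
def l1Norm {p : ℕ} (θ : Fin p → ℝ) : ℝ := ∑ j, |θ j|

/-- The MCMC negative log-likelihood `L_n^m(θ)`, computed from the sample `x` and from the first `m`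
states of the path `y`. -/
def mcmcNegLogLik {d r p n : ℕ} (φ : Config d r → Fin p → ℝ) (h : Config d r → ℝ) (m : ℕ)
    (x : Fin n → Config d r) (y : ℕ → Config d r) (θ : Fin p → ℝ) : ℝ :=
  -((n : ℝ)⁻¹ * ∑ i, θ ⬝ᵥ φ (x i)) +
    Real.log ((m : ℝ)⁻¹ * ∑ i ∈ Finset.range m, Real.exp (θ ⬝ᵥ φ (y i)) / h (y i))

/-- `θhat` is the Elastic-net-penalized MCMC-MLE: it minimizes
`L_n^m(θ) + lam1 ‖θ‖₁ + lam2 ‖θ‖₂²` over `ℝᵖ`. -/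
def IsPenalizedMLE {d r p n : ℕ} (φ : Config d r → Fin p → ℝ) (h : Config d r → ℝ) (m : ℕ)
    (x : Fin n → Config d r) (y : ℕ → Config d r) (lam1 lam2 : ℝ) (θhat : Fin p → ℝ) : Prop :=
  ∀ θ : Fin p → ℝ,
    mcmcNegLogLik φ h m x y θhat + lam1 * l1Norm θhat + lam2 * ∑ j, θhat j ^ 2 ≤
      mcmcNegLogLik φ h m x y θ + lam1 * l1Norm θ + lam2 * ∑ j, θ j ^ 2

/-! ### Sparsity and the compatibility factor -/

/-- The number `‖θ‖₀` of nonzero coordinates. -/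
def l0Norm {p : ℕ} (θ : Fin p → ℝ) : ℕ := (Finset.univ.filter fun j => θ j ≠ 0).card

/-- The cone `{θ : ‖θ_{Tᶜ}‖₁ ≤ ζ ‖θ_T‖₁}`. -/
def cone {p : ℕ} (ζ : ℝ) (T : Finset (Fin p)) : Set (Fin p → ℝ) :=
  {θ | ∑ j ∈ Tᶜ, |θ j| ≤ ζ * ∑ j ∈ T, |θ j|}

/-- The compatibility factor `inf {|T| θᵀ Σ θ / ‖θ_T‖₁² : 0 ≠ θ ∈ cone ζ T}`. The infimum is taken
in the extended reals, so that it is `⊤` when no such `θ` exists, that is, for `T = ∅`; for every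
other `T` the denominators are positive. -/
def compatFactor {p : ℕ} (ζ : ℝ) (T : Finset (Fin p)) (Sig : Matrix (Fin p) (Fin p) ℝ) : EReal :=
  ⨅ θ : Fin p → ℝ, ⨅ _ : θ ∈ cone ζ T, ⨅ _ : θ ≠ 0,
    (((T.card : ℝ) * (θ ⬝ᵥ Sig.mulVec θ) / (∑ j ∈ T, |θ j|) ^ 2 : ℝ) : EReal)

/-! ### Asymptotic notation -/

/-- `a ≍ b` along `n ≥ 1`. -/
def SameOrder (a b : ℕ → ℝ) : Prop :=
  (∃ C > 0, ∀ n ≥ 1, a n ≤ C * b n) ∧ (∃ c > 0, ∀ n ≥ 1, c * b n ≤ a n)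

/-- `Xₙ = O_p(aₙ)`: the family `Xₙ / aₙ`, `n ≥ 1`, is stochastically bounded. -/
def IsBigOp {Ω : ℕ → Type*} [∀ n, MeasurableSpace (Ω n)] (μ : ∀ n, Measure (Ω n))
    (X : ∀ n, Ω n → ℝ) (a : ℕ → ℝ) : Prop :=
  ∀ ε : ℝ, 0 < ε → ∃ M : ℝ, ∀ n ≥ 1, μ n {ω | M * |a n| < |X n ω|} ≤ ENNReal.ofReal ε

/-- `Xₙ = o_p(aₙ)`: the ratio `Xₙ / aₙ` tends to zero in probability. -/
def IsLittleOp {Ω : ℕ → Type*} [∀ n, MeasurableSpace (Ω n)] (μ : ∀ n, Measure (Ω n))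
    (X : ∀ n, Ω n → ℝ) (a : ℕ → ℝ) : Prop :=
  ∀ ε : ℝ, 0 < ε → Tendsto (fun n => μ n {ω | ε * |a n| < |X n ω|}) atTop (𝓝 0)

/-- `√(log p / n) + √(log p / m) + log p / m`. -/
def rate (n m p : ℕ) : ℝ :=
  Real.sqrt (Real.log p / n) + Real.sqrt (Real.log p / m) + Real.log p / m

end SimMRF

end

namespace SimMRF

/-! ### The space `L²(h)` -/

/-! The proof is a deterministic oracle inequality on the event that finitely many empirical moments
are accurate, combined with concentration bounds for that event.

Let `Δ` be a deviation from `θ*` and `Z` the centred statistic `Δᵀ(φ - E φ)`. Up to a linear data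
term, the increment of the MCMC likelihood is the logarithm of the importance sampling average of
`exp Z` over that of `1`. For small `‖Δ‖₁`, second-order lower bounds on `exp` and `log` leave only
the averages of `1`, `Z` and `Z²`. These are linear in the moments of order at most two, so accurate
moments give, uniformly in `Δ`, the bound `ΔᵀH*Δ/8` minus noise (`IsAccurate.le_mcmcNegLogLik_sub`).
By convexity it suffices that the objective increases on an `ℓ₁`-sphere with radius of order `s λ₁`;
failure there would confine `Δ` to a cone and contradict compatibility (`IsAccurate.l1Norm_sub_lt`).

Accuracy follows from Hoeffding's inequality for the data and a Bernstein inequality for the chain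
(`IsStationaryKernel.sum_mul_tiltIter_le`). The Bernstein exponent involves only a variance, hence
`K`, `κ` and `M₁`; `M₂` only restricts the range of deviations, which is harmless as the rate tends
to zero. This is why `A₀` need not depend on `M₂`.

The union bound over pairs of coordinates costs `p²`, leaving a probability of order `p ^ (2 - τ)`.
For large `p`, `τ = 3` is enough. For `p ≤ N` the set of all coordinates replaces the support, so
`λ₁` need not dominate the noise and `τ` can be as large as desired; this costs only a factor `N`.
Finitely many `n` remain, where the ridge penalty bounds the estimator deterministically. -/

lemma l2Norm_nonneg {d r : ℕ} (h f : Config d r → ℝ) : 0 ≤ l2Norm h f := Real.sqrt_nonneg _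

lemma l2Norm_eq_norm {d r : ℕ} {h : Config d r → ℝ} (hh : ∀ y, 0 ≤ h y) (f : Config d r → ℝ) :
    l2Norm h f = ‖(WithLp.toLp 2 fun y => f y * √(h y) : EuclideanSpace ℝ (Config d r))‖ := by
  rw [EuclideanSpace.norm_eq, l2Norm]
  congr 1
  refine Finset.sum_congr rfl fun y _ => ?_
  rw [Real.norm_eq_abs, sq_abs, mul_pow, Real.sq_sqrt (hh y)]

lemma l2Norm_add_le {d r : ℕ} {h : Config d r → ℝ} (hh : ∀ y, 0 ≤ h y) (f g : Config d r → ℝ) :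
    l2Norm h (fun y => f y + g y) ≤ l2Norm h f + l2Norm h g := by
  simp only [l2Norm_eq_norm hh]
  refine le_trans (le_of_eq ?_) (norm_add_le _ _)
  congr 1
  ext y
  simp [add_mul]

lemma sum_mul_mul_le_l2Norm {d r : ℕ} {h : Config d r → ℝ} (hh : ∀ y, 0 ≤ h y)
    (f g : Config d r → ℝ) : ∑ y, f y * g y * h y ≤ l2Norm h f * l2Norm h g := by
  have := Real.sum_mul_le_sqrt_mul_sqrt Finset.univ (fun y => f y * √(h y)) (fun y => g y * √(h y))
  simp only [mul_pow, Real.sq_sqrt (hh _)] at this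
  refine le_trans (le_of_eq ?_) this
  refine Finset.sum_congr rfl fun y _ => ?_
  rw [mul_mul_mul_comm, Real.mul_self_sqrt (hh y)]

lemma l2Norm_const_mul {d r : ℕ} (h : Config d r → ℝ) (c : ℝ) (f : Config d r → ℝ) :
    l2Norm h (fun y => c * f y) = |c| * l2Norm h f := by
  simp only [l2Norm, mul_pow, mul_assoc]
  rw [← Finset.mul_sum, Real.sqrt_mul (sq_nonneg c), Real.sqrt_sq_eq_abs]

lemma l2Norm_le_of_abs_le {d r : ℕ} {h : Config d r → ℝ} (hh : ∀ y, 0 ≤ h y)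
    {f g : Config d r → ℝ} (hfg : ∀ y, |f y| ≤ |g y|) : l2Norm h f ≤ l2Norm h g :=
  Real.sqrt_le_sqrt <| Finset.sum_le_sum fun y _ =>
    mul_le_mul_of_nonneg_right (sq_le_sq.2 (hfg y)) (hh y)

/-- The mean is the best constant approximation in `L²(h)`. -/
lemma l2Norm_sub_mean_le {d r : ℕ} {h : Config d r → ℝ}
    (h1 : ∑ y, h y = 1) (f : Config d r → ℝ) (c : ℝ) :
    l2Norm h (fun y => f y - ∑ z, f z * h z) ≤ l2Norm h (fun y => f y - c) := by
  apply Real.sqrt_le_sqrt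
  set a := ∑ z, f z * h z with ha
  have e (b : ℝ) : ∑ y, (f y - b) ^ 2 * h y = ∑ y, f y ^ 2 * h y - 2 * b * a + b ^ 2 := by
    calc ∑ y, (f y - b) ^ 2 * h y
        = ∑ y, (f y ^ 2 * h y - 2 * b * (f y * h y) + b ^ 2 * h y) :=
          Finset.sum_congr rfl fun y _ => by ring
      _ = _ := by
          rw [Finset.sum_add_distrib, Finset.sum_sub_distrib, ← Finset.mul_sum, ← Finset.mul_sum,
            h1, mul_one]
  rw [e, e]
  nlinarith [sq_nonneg (a - c)]

/-! ### The transition operator on `L²(h)` -/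

namespace IsStationaryKernel

variable {d r : ℕ} {P : Config d r → Config d r → ℝ} {h : Config d r → ℝ}

lemma sum_kernelOp_mul (hP : IsStationaryKernel P h) (f : Config d r → ℝ) :
    ∑ y, kernelOp P f y * h y = ∑ y, f y * h y := by
  simp only [kernelOp, Finset.sum_mul]
  rw [Finset.sum_comm]
  refine Finset.sum_congr rfl fun x _ => ?_
  rw [← hP.invariant x, Finset.mul_sum]
  exact Finset.sum_congr rfl fun y _ => by ring

/-- Cauchy–Schwarz in each row of the kernel, whose entries sum to one, followed by invariance of
`h`. -/
lemma l2Norm_kernelOp_le (hP : IsStationaryKernel P h) (f : Config d r → ℝ) :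
    l2Norm h (kernelOp P f) ≤ l2Norm h f := by
  apply Real.sqrt_le_sqrt
  have e := hP.sum_kernelOp_mul (fun y => f y ^ 2)
  rw [← e]
  refine Finset.sum_le_sum fun y _ => mul_le_mul_of_nonneg_right ?_ (hP.pos y).le
  have := Finset.sum_mul_sq_le_sq_mul_sq Finset.univ (fun x => f x * √(P y x)) (fun x => √(P y x))
  simp only [mul_pow, Real.sq_sqrt (hP.kernel_nonneg y _), hP.kernel_sum, mul_one, mul_assoc,
    Real.mul_self_sqrt (hP.kernel_nonneg y _)] at this
  exact this

/-- An unbounded real supremum would default to `0`; boundedness is what gives a hypothesis on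
`gapKappa` its content. -/
lemma bddAbove_gapSet (hP : IsStationaryKernel P h) :
    BddAbove {t : ℝ | ∃ f : Config d r → ℝ,
      ∑ y, f y * h y = 0 ∧ l2Norm h f ≤ 1 ∧ t = l2Norm h (kernelOp P f)} := by
  refine ⟨1, ?_⟩
  rintro t ⟨f, -, hf, rfl⟩
  exact (hP.l2Norm_kernelOp_le f).trans hf

lemma l2Norm_kernelOp_le_mul (hP : IsStationaryKernel P h) {κ : ℝ} (hκ : gapKappa P h ≤ κ)
    {f : Config d r → ℝ} (hf : ∑ y, f y * h y = 0) :
    l2Norm h (kernelOp P f) ≤ κ * l2Norm h f := by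
  -- A function of norm zero cannot be normalised; the contraction property settles that case.
  rcases (l2Norm_nonneg h f).eq_or_lt with h0 | h0
  · rw [← h0, mul_zero, h0]
    exact hP.l2Norm_kernelOp_le f
  have hk : kernelOp P (fun y => (l2Norm h f)⁻¹ * f y)
      = fun y => (l2Norm h f)⁻¹ * kernelOp P f y := by
    funext y
    simp only [kernelOp, Finset.mul_sum, mul_assoc]
  have key : l2Norm h (kernelOp P (fun y => (l2Norm h f)⁻¹ * f y)) ≤ κ := by
    refine (le_csSup hP.bddAbove_gapSet ⟨_, ?_, ?_, rfl⟩).trans hκ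
    · simp only [mul_assoc, ← Finset.mul_sum, hf, mul_zero]
    · rw [l2Norm_const_mul, abs_of_nonneg (inv_nonneg.2 h0.le), inv_mul_cancel₀ h0.ne']
  rw [hk, l2Norm_const_mul, abs_of_nonneg (inv_nonneg.2 h0.le), inv_mul_le_iff₀ h0] at key
  linarith [mul_comm κ (l2Norm h f)]

end IsStationaryKernel

/-! ### The moment generating function of an additive functional -/

/-- The iterates of `f ↦ P (w f)` started from the constant `1`, that is, the conditional
expectation of `∏_{1 ≤ i ≤ k} w(Yᵢ)` given the initial state. -/
noncomputable def tiltIter {d r : ℕ} (P : Config d r → Config d r → ℝ) (w : Config d r → ℝ) :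
    ℕ → Config d r → ℝ
  | 0 => fun _ => 1
  | k + 1 => kernelOp P fun y => w y * tiltIter P w k y

lemma tiltIter_nonneg {d r : ℕ} {P : Config d r → Config d r → ℝ} (hP : ∀ y x, 0 ≤ P y x)
    {w : Config d r → ℝ} (hw : ∀ y, 0 ≤ w y) (k : ℕ) (y : Config d r) : 0 ≤ tiltIter P w k y := by
  induction k generalizing y with
  | zero => exact zero_le_one
  | succ k ih => exact Finset.sum_nonneg fun x _ => mul_nonneg (mul_nonneg (hw x) (ih x)) (hP y x)

/-- Split each iterate into its `h`-mean `a k` and its fluctuation, of `L²(h)` norm `b k`. Tilting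
couples the two with strength `tσ`, where `σ² = v`, while the spectral gap contracts the
fluctuation. Since `g` is centred, the mean grows only at second order in `t`. Reversibility plays
no role. -/
lemma IsStationaryKernel.sum_mul_tiltIter_le {d r : ℕ} {P : Config d r → Config d r → ℝ}
    {h : Config d r → ℝ} (hP : IsStationaryKernel P h) {κ : ℝ} (hκ : gapKappa P h ≤ κ)
    (hκ0 : 0 ≤ κ) (hκ1 : κ < 1) {g : Config d r → ℝ} {G v t : ℝ} (hg : ∑ y, g y * h y = 0)
    (hG : ∀ y, |g y| ≤ G) (hv : ∑ y, g y ^ 2 * h y ≤ v) (ht : 0 ≤ t) (htG : t * G ≤ (1 - κ) / 4)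
    (k : ℕ) :
    ∑ y, Real.exp (t * g y) * tiltIter P (fun y => Real.exp (t * g y)) k y * h y ≤
      (1 + t ^ 2 * v * (1 + 8 / (1 - κ))) ^ (k + 1) := by
  have hh : ∀ y, 0 ≤ h y := fun y => (hP.pos y).le
  set w : Config d r → ℝ := fun y => Real.exp (t * g y) with hw
  set F := tiltIter P w with hF
  have htg (y) : |t * g y| ≤ (1 - κ) / 4 := by
    rw [abs_mul, abs_of_nonneg ht]
    exact (mul_le_mul_of_nonneg_left (hG y) ht).trans htG
  have htg1 (y) : |t * g y| ≤ 1 := (htg y).trans (by linarith)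
  have hv0 : 0 ≤ v := (Finset.sum_nonneg fun y _ => mul_nonneg (sq_nonneg _) (hh y)).trans hv
  have hF0 (k y) : 0 ≤ F k y := tiltIter_nonneg hP.kernel_nonneg (fun y => (Real.exp_pos _).le) k y
  set σ := √v with hσ
  have hσ0 : 0 ≤ σ := Real.sqrt_nonneg _
  have hσ2 : σ ^ 2 = v := Real.sq_sqrt hv0
  have hgσ : l2Norm h g ≤ σ := Real.sqrt_le_sqrt hv
  have hw1 : l2Norm h (fun y => w y - 1) ≤ 2 * t * σ := by
    calc l2Norm h (fun y => w y - 1) ≤ l2Norm h (fun y => 2 * t * g y) := by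
          refine l2Norm_le_of_abs_le hh fun y => ?_
          calc |w y - 1| ≤ 2 * |t * g y| := Real.abs_exp_sub_one_le (htg1 y)
            _ = |2 * t * g y| := by rw [mul_assoc 2, abs_mul 2]; simp
      _ = 2 * t * l2Norm h g := by rw [l2Norm_const_mul, abs_of_nonneg (by positivity)]
      _ ≤ _ := by gcongr
  have hwm : ∑ y, w y * h y ≤ 1 + t ^ 2 * v := by
    calc ∑ y, w y * h y ≤ ∑ y, (h y + t * (g y * h y) + t ^ 2 * (g y ^ 2 * h y)) := by
          refine Finset.sum_le_sum fun y _ => ?_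
          have := (abs_le.1 (Real.abs_exp_sub_one_sub_id_le (htg1 y))).2
          have h2 : w y ≤ 1 + t * g y + (t * g y) ^ 2 := by simp only [hw]; linarith
          nlinarith [mul_le_mul_of_nonneg_right h2 (hh y)]
      _ = 1 + t ^ 2 * ∑ y, g y ^ 2 * h y := by
          rw [Finset.sum_add_distrib, Finset.sum_add_distrib, ← Finset.mul_sum, ← Finset.mul_sum,
            hg, hP.sum_eq_one]
          ring
      _ ≤ _ := by gcongr
  -- The bound `w ≤ (3 - κ)/2` suffices because `κ(3 - κ) ≤ 1 + κ` is `(1 - κ)² ≥ 0`: half of the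
  -- gap survives the tilting.
  have hwκ (y) : κ * w y ≤ (1 + κ) / 2 := by
    have h2 : w y ≤ 1 + 2 * ((1 - κ) / 4) := by
      have := (abs_le.1 (Real.abs_exp_sub_one_le (htg1 y))).2
      have := htg y
      simp only [hw]; linarith
    nlinarith
  set a : ℕ → ℝ := fun k => ∑ y, F k y * h y with ha
  set b : ℕ → ℝ := fun k => l2Norm h (fun y => F k y - a k) with hb
  have ha0 (k) : 0 ≤ a k := Finset.sum_nonneg fun y _ => mul_nonneg (hF0 k y) (hh y)
  have hab (k) : ∑ y, w y * F k y * h y = a (k + 1) :=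
    (hP.sum_kernelOp_mul fun y => w y * F k y).symm
  -- The covariance of `w` and `F k` under `h` is the only way in which the fluctuation feeds the
  -- mean.
  have stepa (k) : a (k + 1) ≤ (1 + t ^ 2 * v) * a k + 2 * t * σ * b k := by
    have e : ∑ y, w y * F k y * h y
        = a k * ∑ y, w y * h y + ∑ y, (w y - 1) * (F k y - a k) * h y := by
      have e1 : ∑ y, (F k y - a k) * h y = 0 := by
        simp only [sub_mul, Finset.sum_sub_distrib, ← Finset.mul_sum, hP.sum_eq_one, ha]
        ring
      have e2 : ∑ y, (w y - 1) * (F k y - a k) * h y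
          = ∑ y, w y * F k y * h y - a k * ∑ y, w y * h y - ∑ y, (F k y - a k) * h y := by
        rw [Finset.mul_sum, ← Finset.sum_sub_distrib, ← Finset.sum_sub_distrib]
        exact Finset.sum_congr rfl fun y _ => by ring
      rw [e2, e1]; ring
    rw [← hab, e]
    have := sum_mul_mul_le_l2Norm hh (fun y => w y - 1) (fun y => F k y - a k)
    have h3 : l2Norm h (fun y => w y - 1) * b k ≤ 2 * t * σ * b k :=
      mul_le_mul_of_nonneg_right hw1 (l2Norm_nonneg _ _)
    have h4 := mul_le_mul_of_nonneg_left hwm (ha0 k)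
    linarith
  -- The kernel fixes constants, so the gap applies to `w F - c`; replacing the mean `c` by `a k`
  -- can only increase the norm.
  have stepb (k) : b (k + 1) ≤ 2 * t * σ * a k + (1 + κ) / 2 * b k := by
    set c := ∑ y, w y * F k y * h y with hc
    have e1 : b (k + 1) = l2Norm h (kernelOp P fun y => w y * F k y - c) := by
      simp only [hb]
      congr 1
      funext y
      rw [← hab]
      change kernelOp P (fun y => w y * F k y) y - c = _
      simp only [kernelOp, sub_mul, Finset.sum_sub_distrib, ← Finset.mul_sum, hP.kernel_sum,
        mul_one]
    have e2 : l2Norm h (kernelOp P fun y => w y * F k y - c)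
        ≤ κ * l2Norm h (fun y => w y * F k y - c) := by
      refine hP.l2Norm_kernelOp_le_mul hκ ?_
      simp only [sub_mul, Finset.sum_sub_distrib, ← Finset.mul_sum, hP.sum_eq_one, hc]
      ring
    have e3 := l2Norm_sub_mean_le hP.sum_eq_one (fun y => w y * F k y) (a k)
    have e4 : l2Norm h (fun y => w y * F k y - a k) ≤
        l2Norm h (fun y => a k * (w y - 1)) + l2Norm h (fun y => w y * (F k y - a k)) := by
      refine le_trans (le_of_eq ?_) (l2Norm_add_le hh _ _)
      congr 1; funext y; ring
    rw [l2Norm_const_mul, abs_of_nonneg (ha0 k)] at e4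
    have e5 : κ * l2Norm h (fun y => w y * (F k y - a k)) ≤ (1 + κ) / 2 * b k := by
      have f1 := l2Norm_const_mul h κ (fun y => w y * (F k y - a k))
      have f2 := l2Norm_const_mul h ((1 + κ) / 2) (fun y => F k y - a k)
      rw [abs_of_nonneg hκ0] at f1
      rw [abs_of_nonneg (by linarith)] at f2
      simp only [hb]
      rw [← f1, ← f2]
      refine l2Norm_le_of_abs_le hh fun y => ?_
      rw [← mul_assoc, abs_mul, abs_mul ((1 + κ) / 2)]
      refine mul_le_mul_of_nonneg_right ?_ (abs_nonneg _)
      rw [abs_of_nonneg (mul_nonneg hκ0 (Real.exp_pos _).le)]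
      exact (hwκ y).trans (le_abs_self _)
    have e6 : κ * (a k * l2Norm h (fun y => w y - 1)) ≤ 2 * t * σ * a k := by
      have : a k * l2Norm h (fun y => w y - 1) ≤ a k * (2 * t * σ) :=
        mul_le_mul_of_nonneg_left hw1 (ha0 k)
      have h0 : 0 ≤ a k * (2 * t * σ) := mul_nonneg (ha0 k) (by positivity)
      calc _ ≤ κ * (a k * (2 * t * σ)) := mul_le_mul_of_nonneg_left this hκ0
        _ ≤ 1 * (a k * (2 * t * σ)) := mul_le_mul_of_nonneg_right hκ1.le h0
        _ = _ := by ring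
    have e7 := mul_le_mul_of_nonneg_left (e3.trans e4) hκ0
    rw [e1]
    linarith
  have h1κ : 0 < 1 - κ := by linarith
  -- `β` solves `β = 2tσ + (1 + κ)/2 · β`, and `α` is the growth factor of the mean when `b k = β a
  -- k`. As `α ≥ 1`, the pair `α ^ k`, `β α ^ k` dominates both recursions.
  set α := 1 + t ^ 2 * v * (1 + 8 / (1 - κ)) with hα
  set β := 4 * t * σ / (1 - κ) with hβ
  have hβ0 : 0 ≤ β := by positivity
  have hα1 : 1 ≤ α := by
    have : 0 ≤ t ^ 2 * v * (1 + 8 / (1 - κ)) := by positivity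
    linarith
  have eα : 1 + t ^ 2 * v + 2 * t * σ * β = α := by
    rw [hα, hβ, ← hσ2]; field_simp; ring
  have eβ : 2 * t * σ + (1 + κ) / 2 * β = β := by
    rw [hβ]; field_simp; ring
  have main (k) : a k ≤ α ^ k ∧ b k ≤ β * α ^ k := by
    induction k with
    | zero =>
      have : a 0 = 1 := by simp [ha, hF, tiltIter, hP.sum_eq_one]
      refine ⟨by simp [this], ?_⟩
      have : b 0 = 0 := by simp [hb, this, hF, tiltIter, l2Norm]
      rw [this]; positivity
    | succ k ih =>
      have hαk : 0 ≤ α ^ k := by positivity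
      constructor
      · calc a (k + 1) ≤ (1 + t ^ 2 * v) * a k + 2 * t * σ * b k := stepa k
          _ ≤ (1 + t ^ 2 * v) * α ^ k + 2 * t * σ * (β * α ^ k) := by
            gcongr
            · exact ih.1
            · exact ih.2
          _ = α ^ (k + 1) := by rw [pow_succ, ← eα]; ring
      · calc b (k + 1) ≤ 2 * t * σ * a k + (1 + κ) / 2 * b k := stepb k
          _ ≤ 2 * t * σ * α ^ k + (1 + κ) / 2 * (β * α ^ k) := by
            gcongr
            · exact ih.1
            · exact ih.2
          _ = (2 * t * σ + (1 + κ) / 2 * β) * α ^ k := by ring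
          _ = β * α ^ k := by rw [eβ]
          _ ≤ β * α ^ (k + 1) := by
            exact mul_le_mul_of_nonneg_left (pow_le_pow_right₀ hα1 k.le_succ) hβ0
  calc _ = a (k + 1) := hab k
    _ ≤ _ := (main (k + 1)).1

/-- Peeling off the first step of the path is one application of the tilted kernel. -/
lemma sum_paths_eq_tiltIter {d r : ℕ} (P : Config d r → Config d r → ℝ) (w : Config d r → ℝ)
    (k : ℕ) (y : Config d r) :
    ∑ c : Fin k → Config d r,
      (∏ i, P (Fin.cons (α := fun _ => Config d r) y c i.castSucc) (c i)) * ∏ i, w (c i) =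
      tiltIter P w k y := by
  induction k generalizing y with
  | zero => simp [tiltIter]
  | succ k ih =>
    rw [← (Fin.consEquiv fun _ : Fin (k + 1) => Config d r).sum_comp, Fintype.sum_prod_type,
      tiltIter, kernelOp]
    refine Finset.sum_congr rfl fun z _ => ?_
    rw [← ih z, Finset.mul_sum, Finset.sum_mul]
    refine Finset.sum_congr rfl fun c _ => ?_
    simp only [Fin.consEquiv_apply, Fin.prod_univ_succ, Fin.cons_succ, Fin.cons_zero,
      Fin.castSucc_zero, ← Fin.succ_castSucc]
    ring

/-! ### Path probabilities and Bernstein's inequality for the chain. -/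

namespace IsMarkovChain

variable {Ω : Type*} [MeasurableSpace Ω] {μ : Measure Ω} {d r : ℕ}
  {q : Config d r → ℝ} {P : Config d r → Config d r → ℝ} {Y : ℕ → Ω → Config d r}

lemma measureReal_path (hY : IsMarkovChain μ q P Y) (k : ℕ) (y : Config d r)
    (c : Fin k → Config d r) :
    μ.real {ω | (fun i : Fin (k + 1) => Y i ω) = Fin.cons y c} =
      q y * ∏ i, P (Fin.cons (α := fun _ => Config d r) y c i.castSucc) (c i) := by
  set z : Fin (k + 1) → Config d r := Fin.cons y c with hz
  -- The law is stated for infinite sequences; the entries after time `k` are irrelevant and filled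
  -- with `y`.
  have := hY.law k (fun i => if hi : i < k + 1 then z ⟨i, hi⟩ else y)
  rw [Finset.prod_range] at this
  convert this using 1
  · congr 1
    ext ω
    simp only [Set.mem_ofPred_eq, funext_iff]
    constructor
    · intro H i hi
      rw [dif_pos (Nat.lt_succ_of_le hi)]
      exact H ⟨i, Nat.lt_succ_of_le hi⟩
    · intro H i
      have := H i (Nat.le_of_lt_succ i.2)
      rwa [dif_pos i.2] at this
  · congr 1
    refine Finset.prod_congr rfl fun i _ => ?_
    rw [dif_pos (by omega), dif_pos (by omega)]
    rfl

lemma integral_prod [IsProbabilityMeasure μ] (hY : IsMarkovChain μ q P Y) (w : Config d r → ℝ) (k : ℕ) :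
    ∫ ω, ∏ i ∈ Finset.range (k + 1), w (Y i ω) ∂μ = ∑ y, q y * (w y * tiltIter P w k y) := by
  have hm : Measurable fun ω => (fun i : Fin (k + 1) => Y i ω) :=
    measurable_pi_lambda _ fun i => hY.measurable i
  have e1 : ∫ ω, ∏ i ∈ Finset.range (k + 1), w (Y i ω) ∂μ =
      ∫ c : Fin (k + 1) → Config d r, ∏ i, w (c i)
        ∂(μ.map fun ω => (fun i : Fin (k + 1) => Y i ω)) := by
    rw [integral_map hm.aemeasurable (measurable_of_finite _).aestronglyMeasurable]
    simp only [Finset.prod_range]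
  have : IsProbabilityMeasure (μ.map fun ω => (fun i : Fin (k + 1) => Y i ω)) :=
    Measure.isProbabilityMeasure_map hm.aemeasurable
  rw [e1, integral_fintype Integrable.of_finite,
    ← (Fin.consEquiv fun _ : Fin (k + 1) => Config d r).sum_comp, Fintype.sum_prod_type]
  refine Finset.sum_congr rfl fun y _ => ?_
  rw [← sum_paths_eq_tiltIter, Finset.mul_sum, Finset.mul_sum]
  refine Finset.sum_congr rfl fun c _ => ?_
  rw [map_measureReal_apply hm (measurableSet_singleton _)]
  have : μ.real {ω | (fun i : Fin (k + 1) => Y i ω) =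
      (Fin.consEquiv fun _ : Fin (k + 1) => Config d r) (y, c)} = _ := hY.measureReal_path k y c
  simp only [Set.preimage, Set.mem_singleton_iff]
  rw [this]
  simp only [Fin.consEquiv_apply, Fin.prod_univ_succ, Fin.cons_succ, Fin.cons_zero, smul_eq_mul]
  ring

lemma init_nonneg (hY : IsMarkovChain μ q P Y) (y : Config d r) : 0 ≤ q y := by
  have := hY.law 0 fun _ => y
  simp only [Finset.range_zero, Finset.prod_empty, mul_one] at this
  rw [← this]
  exact measureReal_nonneg

/-- A Bernstein inequality for additive functionals of a Markov chain with a spectral gap. -/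
theorem measureReal_sum_ge_le [IsProbabilityMeasure μ] (hY : IsMarkovChain μ q P Y) {h : Config d r → ℝ}
    (hP : IsStationaryKernel P h) {Q κ : ℝ} (hq : ∀ y, q y ≤ Q * h y) (hκ : gapKappa P h ≤ κ)
    (hκ0 : 0 ≤ κ) (hκ1 : κ < 1) {g : Config d r → ℝ} {G v s : ℝ} (hg : ∑ y, g y * h y = 0)
    (hG : ∀ y, |g y| ≤ G) (hv : ∑ y, g y ^ 2 * h y ≤ v) (hv0 : 0 < v) (hs : 0 ≤ s)
    (hsG : s * G ≤ 2 * ((1 + 8 / (1 - κ)) * v) * ((1 - κ) / 4)) {m : ℕ} (hm : 1 ≤ m) :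
    μ.real {ω | m * s ≤ ∑ i ∈ Finset.range m, g (Y i ω)} ≤
      Q * Real.exp (-(m * s ^ 2 / (4 * ((1 + 8 / (1 - κ)) * v)))) := by
  have h1κ : 0 < 1 - κ := by linarith
  set C := (1 + 8 / (1 - κ)) * v with hC
  have hC0 : 0 < C := by positivity
  -- This `t` minimises the Chernoff exponent `-ts + t²C`.
  set t := s / (2 * C) with ht
  have ht0 : 0 ≤ t := by positivity
  obtain ⟨k, rfl⟩ : ∃ k, m = k + 1 := ⟨m - 1, by omega⟩
  have htG : t * G ≤ (1 - κ) / 4 := by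
    rw [ht, div_mul_eq_mul_div, div_le_iff₀ (by positivity)]
    linarith
  set w : Config d r → ℝ := fun y => Real.exp (t * g y) with hw
  have hprod (ω) : Real.exp (t * ∑ i ∈ Finset.range (k + 1), g (Y i ω)) =
      ∏ i ∈ Finset.range (k + 1), w (Y i ω) := by
    rw [Finset.mul_sum, Real.exp_sum]
  have hmgf : mgf (fun ω => ∑ i ∈ Finset.range (k + 1), g (Y i ω)) μ t ≤
      Q * (1 + t ^ 2 * C) ^ (k + 1) := by
    rw [mgf]
    simp only [hprod]
    rw [hY.integral_prod w k]
    have h0 (y) : 0 ≤ w y * tiltIter P w k y :=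
      mul_nonneg (Real.exp_pos _).le
        (tiltIter_nonneg hP.kernel_nonneg (fun y => (Real.exp_pos _).le) k y)
    have hQ : 0 ≤ Q := by
      have : Nonempty (Config d r) := by
        by_contra hne
        rw [not_nonempty_iff] at hne
        have := hP.sum_eq_one
        simp at this
      obtain ⟨y⟩ := this
      have := (hY.init_nonneg y).trans (hq y)
      exact nonneg_of_mul_nonneg_left this (hP.pos y)
    calc ∑ y, q y * (w y * tiltIter P w k y)
        ≤ ∑ y, Q * h y * (w y * tiltIter P w k y) :=
          Finset.sum_le_sum fun y _ => mul_le_mul_of_nonneg_right (hq y) (h0 y)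
      _ = Q * ∑ y, w y * tiltIter P w k y * h y := by
          rw [Finset.mul_sum]
          exact Finset.sum_congr rfl fun y _ => by ring
      _ ≤ Q * (1 + t ^ 2 * C) ^ (k + 1) := by
          refine mul_le_mul_of_nonneg_left ?_ hQ
          have := hP.sum_mul_tiltIter_le hκ hκ0 hκ1 hg hG hv ht0 htG k
          rwa [show t ^ 2 * C = t ^ 2 * v * (1 + 8 / (1 - κ)) by rw [hC]; ring]
  have hQ2 : 0 ≤ Q := by
    have := (mgf_nonneg (X := fun ω => ∑ i ∈ Finset.range (k + 1), g (Y i ω)) (μ := μ)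
      (t := t)).trans hmgf
    exact nonneg_of_mul_nonneg_left this (by positivity)
  have hint : Integrable (fun ω => Real.exp (t * ∑ i ∈ Finset.range (k + 1), g (Y i ω))) μ := by
    have hmeas : Measurable fun ω => Real.exp (t * ∑ i ∈ Finset.range (k + 1), g (Y i ω)) := by
      refine Real.measurable_exp.comp (Measurable.const_mul ?_ _)
      exact Finset.measurable_sum _ fun i _ => (measurable_of_finite g).comp (hY.measurable i)
    refine Integrable.of_bound hmeas.aestronglyMeasurable (Real.exp (t * ((k + 1 : ℕ) * G)))
      (ae_of_all _ fun ω => ?_)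
    rw [Real.norm_eq_abs, Real.abs_exp, Real.exp_le_exp]
    refine mul_le_mul_of_nonneg_left ?_ ht0
    calc _ ≤ ∑ i ∈ Finset.range (k + 1), G :=
          Finset.sum_le_sum fun i _ => (le_abs_self _).trans (hG _)
      _ = _ := by simp
  refine (measure_ge_le_exp_mul_mgf _ ht0 hint).trans ?_
  calc Real.exp (-t * ((k + 1 : ℕ) * s)) * _
      ≤ Real.exp (-t * ((k + 1 : ℕ) * s)) * (Q * Real.exp ((k + 1 : ℕ) * (t ^ 2 * C))) := by
        refine mul_le_mul_of_nonneg_left (hmgf.trans (mul_le_mul_of_nonneg_left ?_ hQ2))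
          (Real.exp_pos _).le
        rw [Real.exp_nat_mul]
        refine pow_le_pow_left₀ (by positivity) ?_ _
        linarith [Real.add_one_le_exp (t ^ 2 * C)]
    _ = Q * Real.exp (-t * ((k + 1 : ℕ) * s) + (k + 1 : ℕ) * (t ^ 2 * C)) := by
        rw [Real.exp_add]; ring
    _ = _ := by
        congr 2
        rw [ht]
        field_simp
        ring

/-- The two-sided form of the Bernstein inequality, for averages. -/
theorem measureReal_abs_mean_gt_le [IsProbabilityMeasure μ] (hY : IsMarkovChain μ q P Y) {h : Config d r → ℝ}
    (hP : IsStationaryKernel P h) {Q κ : ℝ} (hq : ∀ y, q y ≤ Q * h y) (hκ : gapKappa P h ≤ κ)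
    (hκ0 : 0 ≤ κ) (hκ1 : κ < 1) {g : Config d r → ℝ} {G v s : ℝ} (hg : ∑ y, g y * h y = 0)
    (hG : ∀ y, |g y| ≤ G) (hv : ∑ y, g y ^ 2 * h y ≤ v) (hv0 : 0 < v) (hs : 0 ≤ s)
    (hsG : s * G ≤ 2 * ((1 + 8 / (1 - κ)) * v) * ((1 - κ) / 4)) {m : ℕ} (hm : 1 ≤ m) :
    μ.real {ω | s < |(m : ℝ)⁻¹ * ∑ i ∈ Finset.range m, g (Y i ω)|} ≤
      2 * Q * Real.exp (-(m * s ^ 2 / (4 * ((1 + 8 / (1 - κ)) * v)))) := by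
  have hm0 : (0 : ℝ) < m := by exact_mod_cast hm
  have h1 := hY.measureReal_sum_ge_le hP hq hκ hκ0 hκ1 hg hG hv hv0 hs hsG hm
  have h2 := hY.measureReal_sum_ge_le hP hq hκ hκ0 hκ1 (g := fun y => -g y) (G := G) (v := v)
    (by simp [hg]) (by simpa using hG) (by simpa using hv) hv0 hs hsG hm
  refine (measureReal_mono (s₂ := {ω | m * s ≤ ∑ i ∈ Finset.range m, g (Y i ω)} ∪
    {ω | m * s ≤ ∑ i ∈ Finset.range m, -g (Y i ω)}) ?_).trans
    ((measureReal_union_le _ _).trans (by linarith))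
  intro ω hω
  simp only [Set.mem_ofPred_eq, abs_mul, abs_inv, Nat.abs_cast] at hω
  rw [← div_eq_inv_mul, lt_div_iff₀ hm0] at hω
  rcases le_abs.1 hω.le with H | H
  · left; simp only [Set.mem_ofPred_eq]; linarith
  · right; simp only [Set.mem_ofPred_eq, Finset.sum_neg_distrib]; linarith

end IsMarkovChain

/-! ### Hoeffding's inequality for the data. -/

namespace IsIIDSample

variable {Ω : Type*} [MeasurableSpace Ω] {μ : Measure Ω} [IsProbabilityMeasure μ] {d r p n : ℕ}
  {φ : Config d r → Fin p → ℝ} {θ : Fin p → ℝ} {x : Fin n → Ω → Config d r}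

lemma integral_comp (hx : IsIIDSample μ φ θ x) (g : Config d r → ℝ) (i : Fin n) :
    ∫ ω, g (x i ω) ∂μ = ∑ a, pmf φ θ a * g a := by
  have hm := hx.measurable i
  have : IsProbabilityMeasure (μ.map (x i)) := Measure.isProbabilityMeasure_map hm.aemeasurable
  rw [← integral_map (f := g) hm.aemeasurable (measurable_of_finite _).aestronglyMeasurable,
    integral_fintype Integrable.of_finite]
  refine Finset.sum_congr rfl fun a _ => ?_
  rw [map_measureReal_apply hm (measurableSet_singleton _), smul_eq_mul, ← hx.law i a]
  rfl

lemma measureReal_sum_ge_le (hx : IsIIDSample μ φ θ x) {g : Config d r → ℝ} {K s : ℝ}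
    (hK : 0 < K) (hg : ∀ y, |g y| ≤ K) (hs : 0 ≤ s) (hn : 1 ≤ n) :
    μ.real {ω | n * s ≤ ∑ i, (g (x i ω) - ∑ a, pmf φ θ a * g a)} ≤
      Real.exp (-(n * s ^ 2 / (2 * K ^ 2))) := by
  have hn0 : (0 : ℝ) < n := by exact_mod_cast hn
  have hgm : Measurable g := measurable_of_finite g
  have hind : iIndepFun (fun i ω => g (x i ω) - ∑ a, pmf φ θ a * g a) μ :=
    hx.indep.comp (fun _ y => g y - ∑ a, pmf φ θ a * g a) fun _ => hgm.sub_const _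
  have hsub (i : Fin n) : HasSubgaussianMGF (fun ω => g (x i ω) - ∑ a, pmf φ θ a * g a)
      ((‖K - -K‖₊ / 2) ^ 2) μ := by
    have := hasSubgaussianMGF_of_mem_Icc (μ := μ) (X := fun ω => g (x i ω)) (a := -K) (b := K)
      (hgm.comp (hx.measurable i)).aemeasurable (ae_of_all _ fun ω => abs_le.1 (hg _))
    rwa [hx.integral_comp g i] at this
  refine (HasSubgaussianMGF.measure_sum_ge_le_of_iIndepFun hind (s := Finset.univ)
    (fun i _ => hsub i) (by positivity)).trans (le_of_eq ?_)
  congr 1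
  simp only [Finset.sum_const, Finset.card_univ, Fintype.card_fin, nsmul_eq_mul, NNReal.coe_mul,
    NNReal.coe_natCast, NNReal.coe_pow, NNReal.coe_div, coe_nnnorm, NNReal.coe_ofNat,
    Real.norm_eq_abs, sub_neg_eq_add]
  rw [abs_of_pos (by linarith)]
  field_simp
  norm_num

/-- Hoeffding's inequality for averages over the sample. -/
theorem measureReal_abs_mean_gt_le (hx : IsIIDSample μ φ θ x) {g : Config d r → ℝ} {K s : ℝ}
    (hK : 0 < K) (hg : ∀ y, |g y| ≤ K) (hs : 0 ≤ s) (hn : 1 ≤ n) :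
    μ.real {ω | s < |(n : ℝ)⁻¹ * ∑ i, g (x i ω) - ∑ a, pmf φ θ a * g a|} ≤
      2 * Real.exp (-(n * s ^ 2 / (2 * K ^ 2))) := by
  have hn0 : (0 : ℝ) < n := by exact_mod_cast hn
  have h1 := hx.measureReal_sum_ge_le hK hg hs hn
  have h2 := hx.measureReal_sum_ge_le (g := fun y => -g y) hK (by simpa using hg) hs hn
  refine (measureReal_mono
    (s₂ := {ω | n * s ≤ ∑ i, (g (x i ω) - ∑ a, pmf φ θ a * g a)} ∪
      {ω | n * s ≤ ∑ i, (-g (x i ω) - ∑ a, pmf φ θ a * -g a)}) ?_).trans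
    ((measureReal_union_le _ _).trans (by linarith))
  intro ω hω
  simp only [Set.mem_ofPred_eq] at hω
  have e : (n : ℝ)⁻¹ * ∑ i, g (x i ω) - ∑ a, pmf φ θ a * g a =
      (n : ℝ)⁻¹ * ∑ i, (g (x i ω) - ∑ a, pmf φ θ a * g a) := by
    rw [Finset.sum_sub_distrib, Finset.sum_const, Finset.card_univ, Fintype.card_fin, nsmul_eq_mul]
    field_simp
  rw [e, abs_mul, abs_inv, Nat.abs_cast, ← div_eq_inv_mul, lt_div_iff₀ hn0] at hω
  rcases le_abs.1 hω.le with H | H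
  · left; simp only [Set.mem_ofPred_eq]; linarith
  · right
    have e2 : ∑ i, (-g (x i ω) - ∑ a, pmf φ θ a * -g a) =
        -∑ i, (g (x i ω) - ∑ a, pmf φ θ a * g a) := by
      rw [← Finset.sum_neg_distrib]
      refine Finset.sum_congr rfl fun i _ => ?_
      simp only [mul_neg, Finset.sum_neg_distrib]
      ring
    simp only [Set.mem_ofPred_eq, e2]; linarith

end IsIIDSample

/-! ### Basic facts on the exponential family -/

section ExpFamily

variable {d r p : ℕ} (φ : Config d r → Fin p → ℝ) (θ : Fin p → ℝ)

lemma normConst_pos [Nonempty (Config d r)] : 0 < normConst φ θ :=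
  Finset.sum_pos (fun _ _ => Real.exp_pos _) Finset.univ_nonempty

lemma pmf_nonneg (x : Config d r) : 0 ≤ pmf φ θ x :=
  div_nonneg (Real.exp_pos _).le (Finset.sum_nonneg fun _ _ => (Real.exp_pos _).le)

lemma sum_pmf [Nonempty (Config d r)] : ∑ x, pmf φ θ x = 1 := by
  simp only [pmf, ← Finset.sum_div]
  exact div_self (normConst_pos φ θ).ne'

lemma dotProduct_covStat_mulVec (Δ : Fin p → ℝ) :
    Δ ⬝ᵥ (covStat φ θ).mulVec Δ =
      ∑ x, pmf φ θ x * (∑ j, Δ j * (φ x j - meanStat φ θ j)) ^ 2 := by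
  simp only [dotProduct, Matrix.mulVec, covStat, Matrix.of_apply, Finset.mul_sum, Finset.sum_mul,
    sq]
  rw [Finset.sum_comm' (t' := Finset.univ) (s' := fun _ => Finset.univ) (by simp)]
  conv_rhs => rw [Finset.sum_comm]
  refine Finset.sum_congr rfl fun j _ => ?_
  conv_rhs => rw [Finset.sum_comm]
  refine Finset.sum_congr rfl fun k _ => ?_
  exact Finset.sum_congr rfl fun x _ => by ring

lemma dotProduct_covStat_mulVec_nonneg (Δ : Fin p → ℝ) :
    0 ≤ Δ ⬝ᵥ (covStat φ θ).mulVec Δ := by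
  rw [dotProduct_covStat_mulVec]
  exact Finset.sum_nonneg fun x _ => mul_nonneg (pmf_nonneg φ θ x) (sq_nonneg _)

lemma sum_pmf_mul_sub_meanStat [Nonempty (Config d r)] (j : Fin p) :
    ∑ x, pmf φ θ x * (φ x j - meanStat φ θ j) = 0 := by
  simp only [mul_sub, Finset.sum_sub_distrib, ← Finset.sum_mul, sum_pmf]
  simp [meanStat]

variable {φ θ}

lemma abs_sum_pmf_mul_le [Nonempty (Config d r)] {ψ : Config d r → ℝ} {L : ℝ}
    (hψ : ∀ y, |ψ y| ≤ L) : |∑ x, pmf φ θ x * ψ x| ≤ L := by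
  calc |∑ x, pmf φ θ x * ψ x| ≤ ∑ x, |pmf φ θ x * ψ x| := Finset.abs_sum_le_sum_abs _ _
    _ ≤ ∑ x, pmf φ θ x * L := Finset.sum_le_sum fun x _ => by
        rw [abs_mul, abs_of_nonneg (pmf_nonneg φ θ x)]
        exact mul_le_mul_of_nonneg_left (hψ x) (pmf_nonneg φ θ x)
    _ = L := by rw [← Finset.sum_mul, sum_pmf, one_mul]

lemma abs_sub_meanStat_le {K : ℝ} (hφ : ∀ y j, |φ y j| ≤ K) (y : Config d r) (j : Fin p) :
    |φ y j - meanStat φ θ j| ≤ 2 * K := by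
  have : Nonempty (Config d r) := ⟨y⟩
  have h1 := hφ y j
  have h2 : |meanStat φ θ j| ≤ K := abs_sum_pmf_mul_le fun y => hφ y j
  linarith [abs_sub (φ y j) (meanStat φ θ j)]

/-- The compatibility condition over all `ζ` amounts to a bound without any cone. -/
lemma mul_sq_le_card_mul_of_le_compatFactor {C : ℝ}
    (hC : (C : EReal) ≤ ⨅ T : Finset (Fin p), ⨅ ζ : ℝ, ⨅ _ : 1 < ζ,
      compatFactor ζ T (covStat φ θ)) (T : Finset (Fin p)) (Δ : Fin p → ℝ) :
    C * (∑ j ∈ T, |Δ j|) ^ 2 ≤ T.card * (Δ ⬝ᵥ (covStat φ θ).mulVec Δ) := by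
  have hD := dotProduct_covStat_mulVec_nonneg φ θ Δ
  have ha : 0 ≤ ∑ j ∈ T, |Δ j| := Finset.sum_nonneg fun _ _ => abs_nonneg _
  rcases ha.eq_or_lt with h0 | h0
  · rw [← h0]
    simpa using mul_nonneg (Nat.cast_nonneg T.card) hD
  have hb : 0 ≤ ∑ j ∈ Tᶜ, |Δ j| := Finset.sum_nonneg fun _ _ => abs_nonneg _
  -- Every `Δ` that does not vanish on `T` lies in the cone for this `ζ`; the summand `2` keeps `ζ`
  -- above `1`.
  set ζ : ℝ := 2 + (∑ j ∈ Tᶜ, |Δ j|) / ∑ j ∈ T, |Δ j| with hζ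
  have hζ1 : 1 < ζ := by
    have : 0 ≤ (∑ j ∈ Tᶜ, |Δ j|) / ∑ j ∈ T, |Δ j| := div_nonneg hb ha
    linarith
  have hcone : Δ ∈ cone ζ T := by
    change ∑ j ∈ Tᶜ, |Δ j| ≤ ζ * ∑ j ∈ T, |Δ j|
    rw [hζ, add_mul, div_mul_cancel₀ _ h0.ne']
    linarith
  have hne : Δ ≠ 0 := by
    rintro rfl
    simp at h0
  have h1 := hC.trans ((iInf_le _ T).trans ((iInf_le _ ζ).trans (iInf_le _ hζ1)))
  have h2 := h1.trans ((iInf_le _ Δ).trans ((iInf_le _ hcone).trans (iInf_le _ hne)))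
  rw [EReal.coe_le_coe_iff, le_div_iff₀ (by positivity)] at h2
  exact h2

end ExpFamily

lemma l1Norm_nonneg {p : ℕ} (θ : Fin p → ℝ) : 0 ≤ l1Norm θ :=
  Finset.sum_nonneg fun _ _ => abs_nonneg _

/-! ### Importance sampling errors -/

/-- The error of the importance sampling estimate of `∑ₐ p(a ∣ θ) ψ(a)` computed from the first
`m` states of the path `y`. -/
noncomputable def importanceError {d r p : ℕ} (φ : Config d r → Fin p → ℝ) (θ : Fin p → ℝ)
    (h : Config d r → ℝ) (m : ℕ) (y : ℕ → Config d r) (ψ : Config d r → ℝ) : ℝ :=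
  (m : ℝ)⁻¹ * ∑ i ∈ Finset.range m,
    (pmf φ θ (y i) / h (y i) * ψ (y i) - ∑ a, pmf φ θ a * ψ a)

/-- The sample and the path are close enough to their targets: the errors of the first moments of
the data are at most `a`, and the importance sampling errors of the moments up to order two are at
most `b`. -/
structure IsAccurate {d r p n : ℕ} (φ : Config d r → Fin p → ℝ) (θ : Fin p → ℝ)
    (h : Config d r → ℝ) (m : ℕ) (x : Fin n → Config d r) (y : ℕ → Config d r) (a b : ℝ) :
    Prop where
  data : ∀ j, |(n : ℝ)⁻¹ * ∑ i, φ (x i) j - meanStat φ θ j| ≤ a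
  mass : |importanceError φ θ h m y fun _ => 1| ≤ b
  first : ∀ j, |importanceError φ θ h m y fun z => φ z j - meanStat φ θ j| ≤ b
  second : ∀ jk : Fin p × Fin p, |importanceError φ θ h m y fun z =>
    (φ z jk.1 - meanStat φ θ jk.1) * (φ z jk.2 - meanStat φ θ jk.2)| ≤ b

section ImportanceError

variable {d r p : ℕ} {φ : Config d r → Fin p → ℝ} {θ : Fin p → ℝ} {h : Config d r → ℝ} {m : ℕ}
  {y : ℕ → Config d r}

/-- Linearity turns control of finitely many moments into control of `Z` and `Z²` for all `Δ` at
once. -/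
lemma importanceError_sum {ι : Type*} (s : Finset ι) (c : ι → ℝ) (ψ : ι → Config d r → ℝ) :
    importanceError φ θ h m y (fun z => ∑ j ∈ s, c j * ψ j z) =
      ∑ j ∈ s, c j * importanceError φ θ h m y (ψ j) := by
  simp only [importanceError, Finset.sum_sub_distrib, Finset.mul_sum, mul_sub]
  congr 1
  · rw [Finset.sum_comm]
    exact Finset.sum_congr rfl fun j _ => Finset.sum_congr rfl fun i _ => by ring
  · simp only [Finset.sum_const, nsmul_eq_mul, Finset.mul_sum]
    rw [Finset.sum_comm]
    exact Finset.sum_congr rfl fun j _ => Finset.sum_congr rfl fun i _ => by ring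

lemma importanceMean_eq (hm : 1 ≤ m) (ψ : Config d r → ℝ) :
    (m : ℝ)⁻¹ * ∑ i ∈ Finset.range m, pmf φ θ (y i) / h (y i) * ψ (y i) =
      ∑ a, pmf φ θ a * ψ a + importanceError φ θ h m y ψ := by
  have hm0 : (0 : ℝ) < m := by exact_mod_cast hm
  rw [importanceError, Finset.sum_sub_distrib, Finset.sum_const, Finset.card_range, nsmul_eq_mul]
  field_simp
  ring

lemma abs_sum_mul_le {ι : Type*} (s : Finset ι) (c e : ι → ℝ) {b : ℝ} (he : ∀ j ∈ s, |e j| ≤ b) :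
    |∑ j ∈ s, c j * e j| ≤ b * ∑ j ∈ s, |c j| := by
  rw [Finset.mul_sum]
  refine (Finset.abs_sum_le_sum_abs _ _).trans (Finset.sum_le_sum fun j hj => ?_)
  rw [abs_mul, mul_comm]
  exact mul_le_mul_of_nonneg_right (he j hj) (abs_nonneg _)

end ImportanceError

/-! ### Two scalar inequalities -/

/-- Lowering the quadratic coefficient from `1/2` to `1/3` absorbs the cubic remainder. -/
lemma one_add_add_sq_div_three_le_exp {z : ℝ} (hz : |z| ≤ 1 / 2) :
    1 + z + z ^ 2 / 3 ≤ Real.exp z := by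
  have h1 := Real.exp_bound (x := z) (by linarith) (n := 3) (by norm_num)
  norm_num [Finset.sum_range_succ, Nat.factorial] at h1
  have h2 := (abs_le.1 h1).1
  have h3 : |z| ^ 3 ≤ z ^ 2 * (1 / 2) := by
    rw [pow_succ, sq_abs]; gcongr
  nlinarith [sq_nonneg z]

lemma sub_two_mul_sq_le_log_one_add {x : ℝ} (hx : -(1 / 2) ≤ x) :
    x - 2 * x ^ 2 ≤ Real.log (1 + x) := by
  have h0 : 0 < 1 + x := by linarith
  refine le_trans ?_ (Real.one_sub_inv_le_log_of_pos h0)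
  have : 1 - (1 + x)⁻¹ = x / (1 + x) := by field_simp; ring
  rw [this, le_div_iff₀ h0]
  nlinarith [mul_nonneg (sq_nonneg x) (by linarith : 0 ≤ 1 + 2 * x)]

/-! ### The negative log-likelihood -/

section NegLogLik

variable {d r p n : ℕ} {φ : Config d r → Fin p → ℝ} {θ : Fin p → ℝ} {h : Config d r → ℝ} {m : ℕ}
  {x : Fin n → Config d r} {y : ℕ → Config d r}

lemma importanceSum_pos (hh : ∀ y, 0 < h y) (hm : 1 ≤ m) (θ : Fin p → ℝ) :
    0 < (m : ℝ)⁻¹ * ∑ i ∈ Finset.range m, Real.exp (θ ⬝ᵥ φ (y i)) / h (y i) := by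
  have hm0 : (0 : ℝ) < m := by exact_mod_cast hm
  refine mul_pos (inv_pos.2 hm0) (Finset.sum_pos (fun i _ => div_pos (Real.exp_pos _) (hh _)) ?_)
  exact Finset.nonempty_range_iff.2 (by omega)

/-- Multiplying and dividing by `C(θ)` turns the weights `exp(θᵀφ)/h` into density ratios, and the
constant cancels in the difference. Centring `φ` moves the mean into the linear term, where it meets
the data average. -/
lemma mcmcNegLogLik_add_sub (hh : ∀ y, 0 < h y) (hm : 1 ≤ m) (Δ : Fin p → ℝ) :
    mcmcNegLogLik φ h m x y (θ + Δ) - mcmcNegLogLik φ h m x y θ =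
      -((n : ℝ)⁻¹ * ∑ i, Δ ⬝ᵥ φ (x i)) + Δ ⬝ᵥ meanStat φ θ +
        Real.log (((m : ℝ)⁻¹ * ∑ i ∈ Finset.range m, pmf φ θ (y i) / h (y i) *
            Real.exp (∑ j, Δ j * (φ (y i) j - meanStat φ θ j))) /
          ((m : ℝ)⁻¹ * ∑ i ∈ Finset.range m, pmf φ θ (y i) / h (y i) * 1)) := by
  have : Nonempty (Config d r) := ⟨y 0⟩
  have hC := normConst_pos φ θ
  have hm0 : (0 : ℝ) < m := by exact_mod_cast hm
  have e1 : (m : ℝ)⁻¹ * ∑ i ∈ Finset.range m, Real.exp ((θ + Δ) ⬝ᵥ φ (y i)) / h (y i) =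
      normConst φ θ * Real.exp (Δ ⬝ᵥ meanStat φ θ) *
        ((m : ℝ)⁻¹ * ∑ i ∈ Finset.range m, pmf φ θ (y i) / h (y i) *
            Real.exp (∑ j, Δ j * (φ (y i) j - meanStat φ θ j))) := by
    rw [mul_left_comm]
    congr 1
    rw [Finset.mul_sum]
    refine Finset.sum_congr rfl fun i _ => ?_
    have : (θ + Δ) ⬝ᵥ φ (y i) = θ ⬝ᵥ φ (y i) + Δ ⬝ᵥ meanStat φ θ +
        ∑ j, Δ j * (φ (y i) j - meanStat φ θ j) := by
      simp only [dotProduct, Pi.add_apply, ← Finset.sum_add_distrib]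
      exact Finset.sum_congr rfl fun j _ => by ring
    rw [this, Real.exp_add, Real.exp_add, pmf]
    field_simp
  have e2 : (m : ℝ)⁻¹ * ∑ i ∈ Finset.range m, Real.exp (θ ⬝ᵥ φ (y i)) / h (y i) =
      normConst φ θ *
        ((m : ℝ)⁻¹ * ∑ i ∈ Finset.range m, pmf φ θ (y i) / h (y i) * 1) := by
    rw [mul_left_comm]
    congr 1
    rw [Finset.mul_sum]
    refine Finset.sum_congr rfl fun i _ => ?_
    rw [pmf]
    field_simp
  have p1 := importanceSum_pos (φ := φ) (y := y) hh hm (θ + Δ)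
  have p2 := importanceSum_pos (φ := φ) (y := y) hh hm θ
  rw [mcmcNegLogLik, mcmcNegLogLik, e1, e2]
  rw [e1] at p1
  rw [e2] at p2
  have q1 := (pos_iff_pos_of_mul_pos p1).1 (mul_pos hC (Real.exp_pos _))
  have q2 := (pos_iff_pos_of_mul_pos p2).1 hC
  rw [Real.log_mul (mul_pos hC (Real.exp_pos _)).ne' q1.ne', Real.log_mul hC.ne' q2.ne',
    Real.log_mul hC.ne' (Real.exp_pos _).ne', Real.log_exp, Real.log_div q1.ne' q2.ne']
  simp only [add_dotProduct, Finset.sum_add_distrib]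
  ring

/-- Restricted strong convexity of the negative log-likelihood at the true parameter. -/
theorem IsAccurate.le_mcmcNegLogLik_sub {a b K : ℝ} (hacc : IsAccurate φ θ h m x y a b)
    (hh : ∀ y, 0 < h y) (hm : 1 ≤ m) (hb : b ≤ 1 / 2) (hφ : ∀ y j, |φ y j| ≤ K) {Δ : Fin p → ℝ}
    (hΔ : 4 * K * l1Norm Δ ≤ 1) :
    Δ ⬝ᵥ (covStat φ θ).mulVec Δ / 8 - (a + 2 * b) * l1Norm Δ - 9 * b * l1Norm Δ ^ 2 ≤
      mcmcNegLogLik φ h m x y (θ + Δ) - mcmcNegLogLik φ h m x y θ := by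
  have : Nonempty (Config d r) := ⟨y 0⟩
  have hm0 : (0 : ℝ) < m := by exact_mod_cast hm
  have hb0 : 0 ≤ b := (abs_nonneg _).trans hacc.mass
  set Z : Config d r → ℝ := fun z => ∑ j, Δ j * (φ z j - meanStat φ θ j) with hZ
  set W : (Config d r → ℝ) → ℝ := fun ψ =>
    (m : ℝ)⁻¹ * ∑ i ∈ Finset.range m, pmf φ θ (y i) / h (y i) * ψ (y i) with hW
  set D := Δ ⬝ᵥ (covStat φ θ).mulVec Δ with hD
  have hD0 : 0 ≤ D := dotProduct_covStat_mulVec_nonneg φ θ Δ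
  have hl := l1Norm_nonneg Δ
  have hv (i) : 0 ≤ pmf φ θ (y i) / h (y i) := div_nonneg (pmf_nonneg φ θ _) (hh _).le
  have hWmono {ψ χ : Config d r → ℝ} (H : ∀ z, ψ z ≤ χ z) : W ψ ≤ W χ :=
    mul_le_mul_of_nonneg_left (Finset.sum_le_sum fun i _ =>
      mul_le_mul_of_nonneg_left (H _) (hv i)) (inv_nonneg.2 hm0.le)
  have hZb (z) : |Z z| ≤ 1 / 2 := by
    have := abs_sum_mul_le Finset.univ Δ (fun j => φ z j - meanStat φ θ j)
      (fun j _ => abs_sub_meanStat_le hφ z j)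
    have e : 2 * K * ∑ j, |Δ j| ≤ 1 / 2 := by
      change 4 * K * ∑ j, |Δ j| ≤ 1 at hΔ
      linarith
    exact this.trans e
  -- the three importance sampling averages
  have hW1 : |W (fun _ => 1) - 1| ≤ b := by
    have e : W (fun _ => 1) = 1 + importanceError φ θ h m y fun _ => 1 := by
      simp only [hW]
      rw [importanceMean_eq hm (fun _ => 1)]
      simp [sum_pmf]
    rw [e, add_sub_cancel_left]
    exact hacc.mass
  have hWZ : |W Z| ≤ b * l1Norm Δ := by
    have e : W Z = ∑ j, Δ j * importanceError φ θ h m y fun z => φ z j - meanStat φ θ j := by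
      simp only [hW]
      rw [importanceMean_eq hm Z, hZ, importanceError_sum]
      simp only [Finset.mul_sum]
      rw [Finset.sum_comm]
      simp only [mul_left_comm _ (Δ _), ← Finset.mul_sum, sum_pmf_mul_sub_meanStat]
      simp
    rw [e]
    exact abs_sum_mul_le _ _ _ fun j _ => hacc.first j
  have hWZ2 : D - b * l1Norm Δ ^ 2 ≤ W (fun z => Z z ^ 2) := by
    have e0 : (fun z => Z z ^ 2) = fun z => ∑ jk : Fin p × Fin p, (Δ jk.1 * Δ jk.2) *
        ((φ z jk.1 - meanStat φ θ jk.1) * (φ z jk.2 - meanStat φ θ jk.2)) := by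
      funext z
      rw [sq, hZ, Finset.sum_mul_sum, Fintype.sum_prod_type]
      exact Finset.sum_congr rfl fun j _ => Finset.sum_congr rfl fun k _ => by ring
    have e1 : importanceError φ θ h m y (fun z => Z z ^ 2) =
        ∑ jk : Fin p × Fin p, (Δ jk.1 * Δ jk.2) * importanceError φ θ h m y fun z =>
          (φ z jk.1 - meanStat φ θ jk.1) * (φ z jk.2 - meanStat φ θ jk.2) := by
      rw [e0, importanceError_sum]
    have e2 : |importanceError φ θ h m y (fun z => Z z ^ 2)| ≤ b * l1Norm Δ ^ 2 := by
      rw [e1]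
      refine (abs_sum_mul_le _ _ _ fun jk _ => hacc.second jk).trans (le_of_eq ?_)
      rw [sq, l1Norm, Finset.sum_mul_sum, Fintype.sum_prod_type]
      simp only [abs_mul]
    have e3 : W (fun z => Z z ^ 2) = D + importanceError φ θ h m y (fun z => Z z ^ 2) := by
      simp only [hW]
      rw [importanceMean_eq hm (fun z => Z z ^ 2), hD, dotProduct_covStat_mulVec]
    rw [e3]
    linarith [(abs_le.1 e2).1]
  obtain ⟨hW1l, hW1u⟩ := abs_le.1 hW1
  set w := W (fun _ => 1) with hw
  have hw0 : 0 < w := by linarith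
  set η := W Z / w with hη
  set V := W (fun z => Z z ^ 2) / w with hV
  have hWadd : W (fun z => 1 + Z z + Z z ^ 2 / 3) = w + W Z + W (fun z => Z z ^ 2) / 3 := by
    simp only [hw, hW, ← mul_add, ← Finset.sum_add_distrib, mul_div_assoc, Finset.sum_div]
  have hηb : |η| ≤ 2 * b * l1Norm Δ := by
    rw [hη, abs_div, abs_of_pos hw0, div_le_iff₀ hw0]
    have : 0 ≤ b * l1Norm Δ := mul_nonneg hb0 hl
    nlinarith
  -- `η` is a weighted average of `Z`, so the bound on `Z` is inherited without using accuracy.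
  have hη2 : |η| ≤ 1 / 2 := by
    rw [hη, abs_div, abs_of_pos hw0, div_le_iff₀ hw0]
    have h1 : W Z ≤ W fun _ => 1 / 2 := hWmono fun z => (abs_le.1 (hZb z)).2
    have h2 : (W fun _ => -(1 / 2)) ≤ W Z := hWmono fun z => (abs_le.1 (hZb z)).1
    have h3 (c : ℝ) : (W fun _ => c) = c * w := by
      simp only [hw, hW, ← Finset.sum_mul]; ring
    rw [h3] at h1 h2
    exact abs_le.2 ⟨by linarith, by linarith⟩
  have hV0 : 0 ≤ V := by
    refine div_nonneg (mul_nonneg (inv_nonneg.2 hm0.le) (Finset.sum_nonneg fun i _ => ?_)) hw0.le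
    exact mul_nonneg (hv i) (sq_nonneg _)
  have hV1 : V ≤ 1 / 4 := by
    rw [hV, div_le_iff₀ hw0]
    have h1 : W (fun z => Z z ^ 2) ≤ W fun _ => 1 / 4 := by
      refine hWmono (ψ := fun z => Z z ^ 2) (χ := fun _ => 1 / 4) fun z => ?_
      have := sq_le_sq' (abs_le.1 (hZb z)).1 (abs_le.1 (hZb z)).2
      linarith
    have h3 (c : ℝ) : (W fun _ => c) = c * w := by
      simp only [hw, hW, ← Finset.sum_mul]; ring
    rwa [h3] at h1
  have hVl : 2 / 3 * (D - b * l1Norm Δ ^ 2) ≤ V := by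
    rcases le_total (D - b * l1Norm Δ ^ 2) 0 with H | H
    · linarith
    · rw [hV, le_div_iff₀ hw0]
      nlinarith
  -- The square is split by `(η + V/3)² ≤ 2η² + 2V²/9`; then `V ≤ 1/4` gives `4V²/9 ≤ V/9`, and `1/3
  -- - 1/9 = 2/9`.
  have hlog : η + 2 / 9 * V - 4 * η ^ 2 ≤ Real.log (W (fun z => Real.exp (Z z)) / w) := by
    have h1 : 1 + (η + V / 3) ≤ W (fun z => Real.exp (Z z)) / w := by
      rw [le_div_iff₀ hw0]
      have := hWmono fun z => one_add_add_sq_div_three_le_exp (hZb z)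
      rw [hWadd] at this
      have e1 : η * w = W Z := div_mul_cancel₀ _ hw0.ne'
      have e2 : V * w = W (fun z => Z z ^ 2) := div_mul_cancel₀ _ hw0.ne'
      nlinarith
    have h2 : -(1 / 2) ≤ η + V / 3 := by linarith [(abs_le.1 hη2).1]
    have h3 := (sub_two_mul_sq_le_log_one_add h2).trans (Real.log_le_log (by linarith) h1)
    nlinarith [sq_nonneg (η - V / 3)]
  have hlin : |-((n : ℝ)⁻¹ * ∑ i, Δ ⬝ᵥ φ (x i)) + Δ ⬝ᵥ meanStat φ θ| ≤ a * l1Norm Δ := by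
    have e : -((n : ℝ)⁻¹ * ∑ i, Δ ⬝ᵥ φ (x i)) + Δ ⬝ᵥ meanStat φ θ =
        -∑ j, Δ j * ((n : ℝ)⁻¹ * ∑ i, φ (x i) j - meanStat φ θ j) := by
      simp only [dotProduct, mul_sub, Finset.sum_sub_distrib, Finset.mul_sum]
      rw [Finset.sum_comm]
      simp only [mul_left_comm]
      ring
    rw [e, abs_neg]
    exact abs_sum_mul_le _ _ _ fun j _ => hacc.data j
  rw [mcmcNegLogLik_add_sub hh hm]
  change _ ≤ _ + Real.log (W (fun z => Real.exp (Z z)) / w)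
  have hη3 : η ^ 2 ≤ 2 * b * l1Norm Δ ^ 2 := by
    have h1 : η ^ 2 ≤ (2 * b * l1Norm Δ) ^ 2 := sq_le_sq' (by linarith [(abs_le.1 hηb).1])
      (abs_le.1 hηb).2
    have h2 : b * (b * l1Norm Δ ^ 2) ≤ 1 / 2 * (b * l1Norm Δ ^ 2) :=
      mul_le_mul_of_nonneg_right hb (by positivity)
    linarith
  have hbl : 0 ≤ b * l1Norm Δ ^ 2 := by positivity
  -- The constants: `2/9 · 2/3 = 4/27 ≥ 1/8`, and `4/27 + 4 · 2 ≤ 9` for the terms in `b`.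
  linarith [(abs_le.1 hlin).1, (abs_le.1 hηb).1]

end NegLogLik

/-! ### The penalized objective -/

section Objective

variable {d r p n : ℕ} {φ : Config d r → Fin p → ℝ} {θ : Fin p → ℝ} {h : Config d r → ℝ} {m : ℕ}
  {x : Fin n → Config d r} {y : ℕ → Config d r}

/-- Convexity of log-sum-exp, proved like Hölder's inequality: normalise both sums to one and apply
convexity of `exp` termwise. -/
lemma mcmcNegLogLik_add_smul_le (hh : ∀ y, 0 < h y) (hm : 1 ≤ m) (Δ : Fin p → ℝ) {t : ℝ}
    (ht0 : 0 ≤ t) (ht1 : t ≤ 1) :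
    mcmcNegLogLik φ h m x y (θ + t • Δ) ≤
      (1 - t) * mcmcNegLogLik φ h m x y θ + t * mcmcNegLogLik φ h m x y (θ + Δ) := by
  have hm0 : (0 : ℝ) < m := by exact_mod_cast hm
  set A := (m : ℝ)⁻¹ * ∑ i ∈ Finset.range m, Real.exp (θ ⬝ᵥ φ (y i)) / h (y i) with hA
  set B := (m : ℝ)⁻¹ * ∑ i ∈ Finset.range m, Real.exp ((θ + Δ) ⬝ᵥ φ (y i)) / h (y i) with hB
  set C := (m : ℝ)⁻¹ * ∑ i ∈ Finset.range m, Real.exp ((θ + t • Δ) ⬝ᵥ φ (y i)) / h (y i) with hC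
  have hA0 : 0 < A := importanceSum_pos hh hm θ
  have hB0 : 0 < B := importanceSum_pos hh hm (θ + Δ)
  have hC0 : 0 < C := importanceSum_pos hh hm (θ + t • Δ)
  have hpt (i : ℕ) : Real.exp ((θ + t • Δ) ⬝ᵥ φ (y i)) / h (y i) ≤
      Real.exp ((1 - t) * Real.log A + t * Real.log B) *
        ((1 - t) / A * (Real.exp (θ ⬝ᵥ φ (y i)) / h (y i)) +
          t / B * (Real.exp ((θ + Δ) ⬝ᵥ φ (y i)) / h (y i))) := by
    have h1 := convexOn_exp.2 (Set.mem_univ (θ ⬝ᵥ φ (y i) - Real.log A))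
      (Set.mem_univ ((θ + Δ) ⬝ᵥ φ (y i) - Real.log B)) (by linarith : 0 ≤ 1 - t) ht0 (by ring)
    simp only [smul_eq_mul] at h1
    rw [Real.exp_sub, Real.exp_sub, Real.exp_log hA0, Real.exp_log hB0] at h1
    have e : (θ + t • Δ) ⬝ᵥ φ (y i) = (1 - t) * Real.log A + t * Real.log B +
        ((1 - t) * (θ ⬝ᵥ φ (y i) - Real.log A) + t * ((θ + Δ) ⬝ᵥ φ (y i) - Real.log B)) := by
      simp only [add_dotProduct, smul_dotProduct, smul_eq_mul]
      ring
    rw [e, Real.exp_add, mul_div_assoc]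
    refine mul_le_mul_of_nonneg_left ?_ (Real.exp_pos _).le
    calc _ ≤ _ := div_le_div_of_nonneg_right h1 (hh (y i)).le
      _ = _ := by ring
  have hle : C ≤ Real.exp ((1 - t) * Real.log A + t * Real.log B) := by
    have h1 : C ≤ (m : ℝ)⁻¹ * ∑ i ∈ Finset.range m,
        Real.exp ((1 - t) * Real.log A + t * Real.log B) *
        ((1 - t) / A * (Real.exp (θ ⬝ᵥ φ (y i)) / h (y i)) +
          t / B * (Real.exp ((θ + Δ) ⬝ᵥ φ (y i)) / h (y i))) :=
      mul_le_mul_of_nonneg_left (Finset.sum_le_sum fun i _ => hpt i) (inv_nonneg.2 hm0.le)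
    refine h1.trans (le_of_eq ?_)
    rw [← Finset.mul_sum, Finset.sum_add_distrib, ← Finset.mul_sum, ← Finset.mul_sum]
    calc _ = Real.exp ((1 - t) * Real.log A + t * Real.log B) * ((1 - t) / A * A + t / B * B) := by
          rw [hA, hB]; ring
      _ = _ := by
          rw [div_mul_cancel₀ _ hA0.ne', div_mul_cancel₀ _ hB0.ne']; ring
  have hlog : Real.log C ≤ (1 - t) * Real.log A + t * Real.log B := by
    have := Real.log_le_log hC0 hle
    rwa [Real.log_exp] at this
  have hlin : (n : ℝ)⁻¹ * ∑ i, (θ + t • Δ) ⬝ᵥ φ (x i) =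
      (1 - t) * ((n : ℝ)⁻¹ * ∑ i, θ ⬝ᵥ φ (x i)) +
        t * ((n : ℝ)⁻¹ * ∑ i, (θ + Δ) ⬝ᵥ φ (x i)) := by
    simp only [add_dotProduct, smul_dotProduct, smul_eq_mul, Finset.sum_add_distrib,
      ← Finset.mul_sum]
    ring
  change -((n : ℝ)⁻¹ * ∑ i, (θ + t • Δ) ⬝ᵥ φ (x i)) + Real.log C ≤
    (1 - t) * (-((n : ℝ)⁻¹ * ∑ i, θ ⬝ᵥ φ (x i)) + Real.log A) +
      t * (-((n : ℝ)⁻¹ * ∑ i, (θ + Δ) ⬝ᵥ φ (x i)) + Real.log B)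
  rw [hlin]
  linarith

lemma l1Norm_add_smul_le (θ Δ : Fin p → ℝ) {t : ℝ} (ht0 : 0 ≤ t) (ht1 : t ≤ 1) :
    l1Norm (θ + t • Δ) ≤ (1 - t) * l1Norm θ + t * l1Norm (θ + Δ) := by
  simp only [l1Norm, Finset.mul_sum, ← Finset.sum_add_distrib]
  refine Finset.sum_le_sum fun j _ => ?_
  simp only [Pi.add_apply, Pi.smul_apply, smul_eq_mul]
  calc |θ j + t * Δ j| = |(1 - t) * θ j + t * (θ j + Δ j)| := by congr 1; ring
    _ ≤ _ := (abs_add_le _ _).trans (by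
      rw [abs_mul, abs_mul, abs_of_nonneg ht0, abs_of_nonneg (by linarith : 0 ≤ 1 - t)])

lemma sum_sq_add_smul_le (θ Δ : Fin p → ℝ) {t : ℝ} (ht0 : 0 ≤ t) (ht1 : t ≤ 1) :
    ∑ j, (θ + t • Δ) j ^ 2 ≤ (1 - t) * ∑ j, θ j ^ 2 + t * ∑ j, (θ + Δ) j ^ 2 := by
  simp only [Finset.mul_sum, ← Finset.sum_add_distrib]
  refine Finset.sum_le_sum fun j _ => ?_
  simp only [Pi.add_apply, Pi.smul_apply, smul_eq_mul]
  nlinarith [mul_nonneg (mul_nonneg ht0 (by linarith : 0 ≤ 1 - t)) (sq_nonneg (Δ j))]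

lemma l1Norm_smul (t : ℝ) (Δ : Fin p → ℝ) : l1Norm (t • Δ) = |t| * l1Norm Δ := by
  simp [l1Norm, abs_mul, Finset.mul_sum]

/-- The change of the penalty, for a set `T` of coordinates that contains the support. -/
lemma le_penalty_sub {lam1 lam2 B : ℝ} (h1 : 0 ≤ lam1) (h2 : 0 ≤ lam2) (hB : ∀ j, |θ j| ≤ B)
    {T : Finset (Fin p)} (hT : ∀ j ∉ T, θ j = 0) (Δ : Fin p → ℝ) :
    lam1 * (∑ j ∈ Tᶜ, |Δ j| - ∑ j ∈ T, |Δ j|) - 2 * lam2 * B * ∑ j ∈ T, |Δ j| ≤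
      (lam1 * l1Norm (θ + Δ) + lam2 * ∑ j, (θ + Δ) j ^ 2) -
        (lam1 * l1Norm θ + lam2 * ∑ j, θ j ^ 2) := by
  have e1 : ∑ j ∈ Tᶜ, |Δ j| - ∑ j ∈ T, |Δ j| ≤ l1Norm (θ + Δ) - l1Norm θ := by
    simp only [l1Norm, ← Finset.sum_sub_distrib]
    rw [← Finset.sum_add_sum_compl T, sub_eq_neg_add, ← Finset.sum_neg_distrib]
    refine add_le_add (Finset.sum_le_sum fun j _ => ?_) (Finset.sum_le_sum fun j hj => ?_)
    · have := abs_sub_abs_le_abs_sub (θ j) (θ j + Δ j)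
      simp only [sub_add_cancel_left, abs_neg] at this
      simp only [Pi.add_apply]
      linarith
    · simp [hT j (Finset.mem_compl.1 hj)]
  have e2 : -(2 * B * ∑ j ∈ T, |Δ j|) ≤ ∑ j, (θ + Δ) j ^ 2 - ∑ j, θ j ^ 2 := by
    simp only [← Finset.sum_sub_distrib]
    rw [← Finset.sum_add_sum_compl T, Finset.mul_sum, ← Finset.sum_neg_distrib]
    refine (add_zero _).symm.le.trans (add_le_add (Finset.sum_le_sum fun j _ => ?_)
      (Finset.sum_nonneg fun j hj => ?_))
    · simp only [Pi.add_apply]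
      have h3 : |θ j * Δ j| ≤ B * |Δ j| := by
        rw [abs_mul]; exact mul_le_mul_of_nonneg_right (hB j) (abs_nonneg _)
      nlinarith [(abs_le.1 h3).1, sq_nonneg (Δ j)]
    · simp [hT j (Finset.mem_compl.1 hj), sq_nonneg]
  have := mul_le_mul_of_nonneg_left e1 h1
  have := mul_le_mul_of_nonneg_left e2 h2
  linarith

/-- If the objective exceeds its value at `θ` on a sphere around `θ`, then its minimizer lies
inside of that sphere. -/
lemma IsPenalizedMLE.l1Norm_sub_lt {lam1 lam2 R : ℝ} {θhat : Fin p → ℝ}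
    (hθ : IsPenalizedMLE φ h m x y lam1 lam2 θhat) (hh : ∀ y, 0 < h y) (hm : 1 ≤ m)
    (h1 : 0 ≤ lam1) (h2 : 0 ≤ lam2) (hR : 0 < R)
    (H : ∀ Δ, l1Norm Δ = R →
      0 < (mcmcNegLogLik φ h m x y (θ + Δ) - mcmcNegLogLik φ h m x y θ) +
        ((lam1 * l1Norm (θ + Δ) + lam2 * ∑ j, (θ + Δ) j ^ 2) -
          (lam1 * l1Norm θ + lam2 * ∑ j, θ j ^ 2))) :
    l1Norm (θhat - θ) < R := by
  by_contra! hge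
  set Δ := θhat - θ with hΔ
  have hΔ0 : 0 < l1Norm Δ := hR.trans_le hge
  -- The segment from `θ` to the minimizer meets the sphere at parameter `t`, where convexity and
  -- minimality keep the objective at most its value at `θ`.
  set t := R / l1Norm Δ with ht
  have ht0 : 0 ≤ t := by positivity
  have ht1 : t ≤ 1 := (div_le_one hΔ0).2 hge
  have hn : l1Norm (t • Δ) = R := by
    rw [l1Norm_smul, abs_of_nonneg ht0, ht, div_mul_cancel₀ _ hΔ0.ne']
  have h3 := H _ hn
  have h4 := mcmcNegLogLik_add_smul_le (φ := φ) (x := x) (y := y) (θ := θ) hh hm Δ ht0 ht1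
  have h5 := mul_le_mul_of_nonneg_left (l1Norm_add_smul_le θ Δ ht0 ht1) h1
  have h6 := mul_le_mul_of_nonneg_left (sum_sq_add_smul_le θ Δ ht0 ht1) h2
  have h7 := mul_le_mul_of_nonneg_left (hθ θ) ht0
  have e : θ + Δ = θhat := by rw [hΔ]; abel
  rw [e] at h4 h5 h6
  linarith

/-- The oracle inequality for the penalized estimator, given accurate moments. The set `T` either
contains the support while `lam1` dominates the noise, or it consists of all coordinates. -/
theorem IsAccurate.l1Norm_sub_lt {a b K lam1 lam2 B C E R : ℝ} {θhat : Fin p → ℝ}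
    (hacc : IsAccurate φ θ h m x y a b) (hθ : IsPenalizedMLE φ h m x y lam1 lam2 θhat)
    (hh : ∀ y, 0 < h y) (hm : 1 ≤ m) (h1 : 0 < lam1) (h2 : 0 ≤ lam2) (hb : b ≤ 1 / 2)
    (hφ : ∀ y j, |φ y j| ≤ K) (hB : ∀ j, |θ j| ≤ B) (hC0 : 0 < C)
    (hC : (C : EReal) ≤ ⨅ T : Finset (Fin p), ⨅ ζ : ℝ, ⨅ _ : 1 < ζ,
      compatFactor ζ T (covStat φ θ))
    {T : Finset (Fin p)} (hT : ∀ j ∉ T, θ j = 0)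
    (hTz : a + 2 * b ≤ lam1 / 2 ∨ T = Finset.univ)
    (hE : a + 2 * b + 5 / 4 * lam1 + 2 * lam2 * B ≤ lam1 * E) (hE0 : 0 ≤ E)
    (hR : 8 * E * (1 + 4 * E) / C * T.card * lam1 < R) (hKR : 4 * K * R ≤ 1)
    (hbR : 36 * b * R ≤ lam1) :
    l1Norm (θhat - θ) < R := by
  have hR0 : 0 < R := lt_of_le_of_lt (by positivity) hR
  refine hθ.l1Norm_sub_lt hh hm h1.le h2 hR0 fun Δ hΔ => ?_
  by_contra! hneg
  have hL := hacc.le_mcmcNegLogLik_sub hh hm hb hφ (Δ := Δ) (by rw [hΔ]; exact hKR)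
  have hP := le_penalty_sub h1.le h2 hB hT Δ
  have hcomp := mul_sq_le_card_mul_of_le_compatFactor hC T Δ
  rw [hΔ] at hL
  set D := Δ ⬝ᵥ (covStat φ θ).mulVec Δ with hD
  have hD0 : 0 ≤ D := dotProduct_covStat_mulVec_nonneg φ θ Δ
  have hab : ∑ j ∈ T, |Δ j| + ∑ j ∈ Tᶜ, |Δ j| = R := by
    rw [Finset.sum_add_sum_compl, ← hΔ]; rfl
  have hu0 : 0 ≤ ∑ j ∈ T, |Δ j| := Finset.sum_nonneg fun _ _ => abs_nonneg _
  have hv0 : 0 ≤ ∑ j ∈ Tᶜ, |Δ j| := Finset.sum_nonneg fun _ _ => abs_nonneg _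
  -- Noise off `T` is either dominated by half of `lam1` or absent because `Tᶜ` is empty.
  have hz : (a + 2 * b) * ∑ j ∈ Tᶜ, |Δ j| ≤ lam1 / 2 * ∑ j ∈ Tᶜ, |Δ j| := by
    rcases hTz with hz | rfl
    · exact mul_le_mul_of_nonneg_right hz hv0
    · simp
  set u := ∑ j ∈ T, |Δ j| with hu
  set v := ∑ j ∈ Tᶜ, |Δ j| with hv
  have hq : 9 * b * R ^ 2 ≤ lam1 / 4 * (u + v) := by
    rw [hab]
    nlinarith
  -- Off `T`, the noise takes `lam1/2` and the quadratic error `lam1/4`, leaving `lam1/4`. On `T`,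
  -- the penalty and the quadratic error add up to `5/4 · lam1`.
  have key : D / 8 + lam1 / 4 * v ≤ lam1 * E * u := by
    have h3 := mul_le_mul_of_nonneg_right hE hu0
    have h4 : (a + 2 * b) * R = (a + 2 * b) * u + (a + 2 * b) * v := by rw [← hab]; ring
    rw [h4] at hL
    linarith
  have hv : v ≤ 4 * E * u := by
    have : lam1 * v ≤ lam1 * (4 * E * u) := by linarith
    exact le_of_mul_le_mul_left this h1
  have hRu : R ≤ (1 + 4 * E) * u := by rw [← hab]; linarith
  have hu_pos : 0 < u := by
    rcases hu0.eq_or_lt with h0 | h0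
    · rw [← h0, mul_zero] at hRu; linarith
    · exact h0
  have hDu : D ≤ 8 * (lam1 * E * u) := by
    have : 0 ≤ lam1 / 4 * v := by positivity
    linarith
  have hu1 : C * u ≤ T.card * (8 * (lam1 * E)) := by
    have h5 := mul_le_mul_of_nonneg_left hDu (Nat.cast_nonneg (α := ℝ) T.card)
    have : C * u * u ≤ T.card * (8 * (lam1 * E)) * u := by nlinarith
    exact le_of_mul_le_mul_right this hu_pos
  have : R ≤ 8 * E * (1 + 4 * E) / C * T.card * lam1 := by
    have e : 8 * E * (1 + 4 * E) / C * T.card * lam1 =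
        (1 + 4 * E) * (T.card * (8 * (lam1 * E))) / C := by ring
    rw [e, le_div_iff₀ hC0]
    have := mul_le_mul_of_nonneg_left hu1 (by positivity : 0 ≤ 1 + 4 * E)
    nlinarith
  linarith

/-- The penalized estimator is bounded for any fixed model. -/
lemma IsPenalizedMLE.exists_bound (hstat : ∀ y, 0 < h y) (h1 : ∑ y, h y = 1) (hm : 1 ≤ m)
    (hn : 1 ≤ n) {K : ℝ} (hφ : ∀ y j, |φ y j| ≤ K) {lam1 lam2 : ℝ} (hl1 : 0 ≤ lam1)
    (hl2 : 0 < lam2) :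
    ∃ D : ℝ, ∀ (x : Fin n → Config d r) (y : ℕ → Config d r) (θhat : Fin p → ℝ),
      IsPenalizedMLE φ h m x y lam1 lam2 θhat → l1Norm θhat ≤ D := by
  have hm0 : (0 : ℝ) < m := by exact_mod_cast hm
  have hn0 : (0 : ℝ) < n := by exact_mod_cast hn
  have hh1 (z) : h z ≤ 1 := h1 ▸ Finset.single_le_sum (fun y _ => (hstat y).le) (Finset.mem_univ z)
  set S : ℝ := ∑ y, (h y)⁻¹ with hS
  have hS0 : 0 ≤ S := Finset.sum_nonneg fun y _ => inv_nonneg.2 (hstat y).le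
  refine ⟨max 1 (p * (S + 2 * K) / lam2), fun x y θhat hθ => ?_⟩
  set t := l1Norm θhat with ht
  have ht0 : 0 ≤ t := l1Norm_nonneg _
  have hdot (z) : |θhat ⬝ᵥ φ z| ≤ K * t :=
    abs_sum_mul_le Finset.univ θhat (φ z) fun j _ => hφ z j
  -- The likelihood falls at most linearly in `‖θhat‖₁`, while the ridge penalty grows
  -- quadratically; comparison with `θ = 0` therefore bounds the minimizer.
  have hlow : -(2 * K * t) ≤ mcmcNegLogLik φ h m x y θhat := by
    have e1 : (n : ℝ)⁻¹ * ∑ i, θhat ⬝ᵥ φ (x i) ≤ K * t := by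
      rw [← div_eq_inv_mul, div_le_iff₀ hn0]
      calc _ ≤ ∑ i : Fin n, K * t := Finset.sum_le_sum fun i _ => (abs_le.1 (hdot _)).2
        _ = _ := by simp [mul_comm]
    have e2 : Real.exp (-(K * t)) ≤
        (m : ℝ)⁻¹ * ∑ i ∈ Finset.range m, Real.exp (θhat ⬝ᵥ φ (y i)) / h (y i) := by
      rw [← div_eq_inv_mul, le_div_iff₀ hm0]
      calc _ = ∑ i ∈ Finset.range m, Real.exp (-(K * t)) := by simp [mul_comm]
        _ ≤ _ := Finset.sum_le_sum fun i _ => by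
          rw [le_div_iff₀ (hstat _)]
          calc _ ≤ Real.exp (-(K * t)) * 1 :=
                mul_le_mul_of_nonneg_left (hh1 _) (Real.exp_pos _).le
            _ ≤ _ := by
              rw [mul_one]
              exact Real.exp_le_exp.2 (abs_le.1 (hdot _)).1
    have e3 := Real.log_le_log (Real.exp_pos _) e2
    rw [Real.log_exp] at e3
    rw [mcmcNegLogLik]
    linarith
  have hzero : mcmcNegLogLik φ h m x y 0 ≤ S := by
    have e1 := importanceSum_pos (φ := φ) (y := y) hstat hm 0
    have e2 : (m : ℝ)⁻¹ * ∑ i ∈ Finset.range m, Real.exp ((0 : Fin p → ℝ) ⬝ᵥ φ (y i)) / h (y i)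
        ≤ S := by
      rw [← div_eq_inv_mul, div_le_iff₀ hm0]
      calc _ ≤ ∑ i ∈ Finset.range m, S := Finset.sum_le_sum fun i _ => by
            rw [zero_dotProduct, Real.exp_zero, one_div]
            exact Finset.single_le_sum (f := fun y => (h y)⁻¹)
              (fun y _ => inv_nonneg.2 (hstat y).le) (Finset.mem_univ (y i))
        _ = _ := by simp [mul_comm]
    rw [mcmcNegLogLik]
    simp only [zero_dotProduct, Finset.sum_const_zero, mul_zero, neg_zero, zero_add] at e1 e2 ⊢
    linarith [Real.log_le_sub_one_of_pos e1]
  have hmin := hθ 0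
  have e0 : l1Norm (0 : Fin p → ℝ) = 0 := by simp [l1Norm]
  rw [e0] at hmin
  simp only [Pi.zero_apply, ne_eq, OfNat.ofNat_ne_zero, not_false_eq_true, zero_pow,
    Finset.sum_const_zero, mul_zero, add_zero] at hmin
  have hsq : t ^ 2 ≤ p * ∑ j, θhat j ^ 2 := by
    have := sq_sum_le_card_mul_sum_sq (s := Finset.univ) (f := fun j => |θhat j|)
    simpa [ht, l1Norm] using this
  have hq : lam2 * ∑ j, θhat j ^ 2 ≤ S + 2 * K * t := by
    have : 0 ≤ lam1 * t := mul_nonneg hl1 ht0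
    linarith
  by_contra! hlt
  have ht1 : 1 < t := (le_max_left _ _).trans_lt hlt
  have ht2 : p * (S + 2 * K) / lam2 < t := (le_max_right _ _).trans_lt hlt
  rw [div_lt_iff₀ hl2] at ht2
  have h3 : lam2 * t ^ 2 ≤ p * (S + 2 * K * t) := by
    calc lam2 * t ^ 2 ≤ lam2 * (p * ∑ j, θhat j ^ 2) := mul_le_mul_of_nonneg_left hsq hl2.le
      _ = p * (lam2 * ∑ j, θhat j ^ 2) := by ring
      _ ≤ _ := mul_le_mul_of_nonneg_left hq (Nat.cast_nonneg _)
  have h4 : (p : ℝ) * (S + 2 * K * t) ≤ p * (S + 2 * K) * t := by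
    have : S ≤ S * t := le_mul_of_one_le_right hS0 ht1.le
    have := mul_le_mul_of_nonneg_left this (Nat.cast_nonneg (α := ℝ) p)
    linarith
  have h5 := mul_lt_mul_of_pos_right ht2 (by linarith : 0 < t)
  nlinarith

end Objective

/-! ### Probability that the moments are accurate -/

/-- A bound on the second moments of the importance sampling summands. -/
noncomputable def varProxy (K M₁ : ℝ) : ℝ := 16 * (1 + K ^ 2 + K ^ 4) * max M₁ 1

/-- The variance constant in the Bernstein inequality for a chain with spectral gap `1 - κ`. -/
noncomputable def chainVar (K κ M₁ : ℝ) : ℝ := (1 + 8 / (1 - κ)) * varProxy K M₁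

/-- The factor of `√(log p / n)` and `√(log p / m)` that makes a single deviation have probability
of order `p ^ (-τ)`. -/
noncomputable def noiseLevel (K κ M₁ τ : ℝ) : ℝ := √(τ * (2 * K ^ 2 + 4 * chainVar K κ M₁))

lemma varProxy_pos (K M₁ : ℝ) : 0 < varProxy K M₁ := by
  have : 0 < max M₁ 1 := lt_max_of_lt_right one_pos
  unfold varProxy
  positivity

lemma chainVar_pos (K M₁ : ℝ) {κ : ℝ} (hκ : κ < 1) : 0 < chainVar K κ M₁ := by
  have := varProxy_pos K M₁
  have : 0 < 1 - κ := by linarith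
  unfold chainVar
  positivity

section Accuracy

variable {Ω : Type*} [MeasurableSpace Ω] {μ : Measure Ω} [IsProbabilityMeasure μ] {d r p n : ℕ}
  {φ : Config d r → Fin p → ℝ} {θ : Fin p → ℝ} {x : Fin n → Ω → Config d r}
  {q h : Config d r → ℝ} {P : Config d r → Config d r → ℝ} {Y : ℕ → Ω → Config d r}
  {K κ M₁ M₂ Q : ℝ} {m : ℕ}

/-- The second moment of the weighted summand is at most `L² M₁`, so `M₂` enters only through the
sup bound `G`. -/
lemma IsMarkovChain.measureReal_importanceError_gt_le (hY : IsMarkovChain μ q P Y)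
    (hP : IsStationaryKernel P h) (hq : ∀ y, q y ≤ Q * h y) (hκ : gapKappa P h ≤ κ) (hκ0 : 0 ≤ κ)
    (hκ1 : κ < 1) (hM₁ : ratioSq φ θ h ≤ M₁) (hM₂ : ratioMax φ θ h ≤ M₂) (hm : 1 ≤ m)
    {ψ : Config d r → ℝ} {L b v G : ℝ} (hψ : ∀ y, |ψ y| ≤ L) (hL : L ^ 2 * max M₁ 1 ≤ v)
    (hv : 0 < v) (hLG : L * (M₂ + 1) ≤ G) (hb : 0 ≤ b)
    (hbG : b * G ≤ 2 * ((1 + 8 / (1 - κ)) * v) * ((1 - κ) / 4)) :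
    μ.real {ω | b < |importanceError φ θ h m (fun i => Y i ω) ψ|} ≤
      2 * Q * Real.exp (-(m * b ^ 2 / (4 * ((1 + 8 / (1 - κ)) * v)))) := by
  set c := ∑ a, pmf φ θ a * ψ a with hc
  have hw (y) : pmf φ θ y / h y * h y = pmf φ θ y := div_mul_cancel₀ _ (hP.pos y).ne'
  have hmean : ∑ y, pmf φ θ y / h y * ψ y * h y = c := by
    rw [hc]
    exact Finset.sum_congr rfl fun y _ => by rw [mul_right_comm, hw]
  refine hY.measureReal_abs_mean_gt_le hP hq hκ hκ0 hκ1
    (g := fun y => pmf φ θ y / h y * ψ y - c) ?_ (G := G) ?_ ?_ hv hb hbG hm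
  · simp only [sub_mul, Finset.sum_sub_distrib, ← Finset.mul_sum, hP.sum_eq_one, mul_one]
    rw [hmean, sub_self]
  · intro y
    have : Nonempty (Config d r) := ⟨y⟩
    have h1 : |c| ≤ L := abs_sum_pmf_mul_le hψ
    have h0 : 0 ≤ pmf φ θ y / h y := div_nonneg (pmf_nonneg φ θ y) (hP.pos y).le
    have h2 : pmf φ θ y / h y ≤ M₂ :=
      (le_ciSup (f := fun y => pmf φ θ y / h y) (Set.finite_range _).bddAbove y).trans hM₂
    have h3 : |pmf φ θ y / h y * ψ y| ≤ M₂ * L := by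
      rw [abs_mul, abs_of_nonneg h0]
      exact mul_le_mul h2 (hψ y) (abs_nonneg _) (h0.trans h2)
    have := abs_sub (pmf φ θ y / h y * ψ y) c
    linarith
  · calc ∑ y, (pmf φ θ y / h y * ψ y - c) ^ 2 * h y
        = ∑ y, (pmf φ θ y / h y * ψ y) ^ 2 * h y - c ^ 2 := by
          have e (y) : (pmf φ θ y / h y * ψ y - c) ^ 2 * h y =
              (pmf φ θ y / h y * ψ y) ^ 2 * h y - 2 * c * (pmf φ θ y / h y * ψ y * h y) +
                c ^ 2 * h y := by ring
          simp only [e, Finset.sum_add_distrib, Finset.sum_sub_distrib, ← Finset.mul_sum]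
          rw [hmean, hP.sum_eq_one]
          ring
      _ ≤ ∑ y, (pmf φ θ y / h y * ψ y) ^ 2 * h y := by linarith [sq_nonneg c]
      _ ≤ ∑ y, L ^ 2 * (h y * (pmf φ θ y / h y) ^ 2) := by
          refine Finset.sum_le_sum fun y _ => ?_
          have h4 : ψ y ^ 2 ≤ L ^ 2 := sq_le_sq' (abs_le.1 (hψ y)).1 (abs_le.1 (hψ y)).2
          have h5 := mul_le_mul_of_nonneg_right h4
            (mul_nonneg (hP.pos y).le (sq_nonneg (pmf φ θ y / h y)))
          calc _ = ψ y ^ 2 * (h y * (pmf φ θ y / h y) ^ 2) := by ring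
            _ ≤ _ := h5
      _ = L ^ 2 * ratioSq φ θ h := by rw [ratioSq, Finset.mul_sum]
      _ ≤ L ^ 2 * max M₁ 1 :=
          mul_le_mul_of_nonneg_left (hM₁.trans (le_max_left _ _)) (sq_nonneg _)
      _ ≤ v := hL

lemma measureReal_not_isAccurate_le (hx : IsIIDSample μ φ θ x) (hY : IsMarkovChain μ q P Y)
    (hP : IsStationaryKernel P h) (hq : ∀ y, q y ≤ Q * h y) (hκ : gapKappa P h ≤ κ) (hκ0 : 0 ≤ κ)
    (hκ1 : κ < 1) (hM₁ : ratioSq φ θ h ≤ M₁) (hM₂ : ratioMax φ θ h ≤ M₂) (hn : 1 ≤ n) (hm : 1 ≤ m)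
    (hK : 0 < K) (hφ : ∀ y j, |φ y j| ≤ K) {a b : ℝ} (ha : 0 ≤ a) (hb : 0 ≤ b)
    (hbG : b * ((1 + 2 * K + 4 * K ^ 2) * (M₂ + 1)) ≤ 2 * chainVar K κ M₁ * ((1 - κ) / 4)) :
    μ.real {ω | ¬ IsAccurate φ θ h m (fun i => x i ω) (fun i => Y i ω) a b} ≤
      p * (2 * Real.exp (-(n * a ^ 2 / (2 * K ^ 2)))) +
        (1 + p + (p : ℝ) ^ 2) * (2 * Q * Real.exp (-(m * b ^ 2 / (4 * chainVar K κ M₁)))) := by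
  have hMpos : 1 ≤ max M₁ 1 := le_max_right _ _
  have hM2 : 0 ≤ M₂ + 1 := by
    have : Nonempty (Config d r) := by
      by_contra hne
      rw [not_nonempty_iff] at hne
      have := hP.sum_eq_one
      simp at this
    obtain ⟨y⟩ := this
    have h0 : 0 ≤ pmf φ θ y / h y := div_nonneg (pmf_nonneg φ θ y) (hP.pos y).le
    have h2 : pmf φ θ y / h y ≤ M₂ :=
      (le_ciSup (f := fun y => pmf φ θ y / h y) (Set.finite_range _).bddAbove y).trans hM₂
    linarith
  have chain {ψ : Config d r → ℝ} {L : ℝ} (hψ : ∀ y, |ψ y| ≤ L)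
      (hL2 : L ^ 2 ≤ 16 * (1 + K ^ 2 + K ^ 4)) (hL : L ≤ 1 + 2 * K + 4 * K ^ 2) :=
    hY.measureReal_importanceError_gt_le hP hq hκ hκ0 hκ1 hM₁ hM₂ hm hψ
      (v := varProxy K M₁) (mul_le_mul_of_nonneg_right hL2 (by linarith)) (varProxy_pos K M₁)
      (mul_le_mul_of_nonneg_right hL hM2) hb hbG
  have hK2 : 0 ≤ K ^ 2 := sq_nonneg K
  have hK4 : 0 ≤ K ^ 4 := by positivity
  set δ := 2 * Q * Real.exp (-(m * b ^ 2 / (4 * chainVar K κ M₁))) with hδ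
  set ε := 2 * Real.exp (-(n * a ^ 2 / (2 * K ^ 2))) with hε
  have p1 (j : Fin p) : μ.real {ω | a < |(n : ℝ)⁻¹ * ∑ i, φ (x i ω) j - meanStat φ θ j|} ≤ ε :=
    hx.measureReal_abs_mean_gt_le (g := fun y => φ y j) hK (fun y => hφ y j) ha hn
  have p2 : μ.real {ω | b < |importanceError φ θ h m (fun i => Y i ω) fun _ => 1|} ≤ δ :=
    chain (L := 1) (by simp) (by linarith) (by linarith)
  have p3 (j : Fin p) : μ.real {ω | b < |importanceError φ θ h m (fun i => Y i ω)
      fun z => φ z j - meanStat φ θ j|} ≤ δ :=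
    chain (L := 2 * K) (fun y => abs_sub_meanStat_le hφ y j) (by nlinarith) (by linarith)
  have p4 (jk : Fin p × Fin p) : μ.real {ω | b < |importanceError φ θ h m (fun i => Y i ω)
      fun z => (φ z jk.1 - meanStat φ θ jk.1) * (φ z jk.2 - meanStat φ θ jk.2)|} ≤ δ := by
    refine chain (L := 4 * K ^ 2) (fun y => ?_) (by nlinarith) (by linarith)
    rw [abs_mul]
    calc _ ≤ 2 * K * (2 * K) := mul_le_mul (abs_sub_meanStat_le hφ y _)
          (abs_sub_meanStat_le hφ y _) (abs_nonneg _) (by positivity)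
      _ = _ := by ring
  have hsub : {ω | ¬ IsAccurate φ θ h m (fun i => x i ω) (fun i => Y i ω) a b} ⊆
      (⋃ j, {ω | a < |(n : ℝ)⁻¹ * ∑ i, φ (x i ω) j - meanStat φ θ j|}) ∪
      ({ω | b < |importanceError φ θ h m (fun i => Y i ω) fun _ => 1|} ∪
      ((⋃ j, {ω | b < |importanceError φ θ h m (fun i => Y i ω)
        fun z => φ z j - meanStat φ θ j|}) ∪
      ⋃ jk : Fin p × Fin p, {ω | b < |importanceError φ θ h m (fun i => Y i ω)
        fun z => (φ z jk.1 - meanStat φ θ jk.1) * (φ z jk.2 - meanStat φ θ jk.2)|})) := by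
    intro ω hω
    by_contra hnot
    simp only [Set.mem_union, Set.mem_iUnion, Set.mem_ofPred_eq, not_or, not_exists,
      not_lt] at hnot
    exact hω ⟨hnot.1, hnot.2.1, hnot.2.2.1, hnot.2.2.2⟩
  refine (measureReal_mono hsub).trans ((measureReal_union_le _ _).trans (add_le_add ?_ ?_))
  · refine (measureReal_iUnion_fintype_le _).trans ((Finset.sum_le_sum fun j _ => p1 j).trans ?_)
    simp
  · have e : (1 + p + (p : ℝ) ^ 2) * δ = δ + (p * δ + (p : ℝ) ^ 2 * δ) := by ring
    rw [e]
    refine (measureReal_union_le _ _).trans (add_le_add p2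
      ((measureReal_union_le _ _).trans (add_le_add ?_ ?_)))
    · refine (measureReal_iUnion_fintype_le _).trans
        ((Finset.sum_le_sum fun j _ => p3 j).trans ?_)
      simp
    · refine (measureReal_iUnion_fintype_le _).trans
        ((Finset.sum_le_sum fun j _ => p4 j).trans ?_)
      simp [sq]

/-- With this noise level, both exponents are at least `τ log p`; the number of events is of order
`p²`. -/
lemma measureReal_not_isAccurate_noiseLevel_le (hx : IsIIDSample μ φ θ x)
    (hY : IsMarkovChain μ q P Y)
    (hP : IsStationaryKernel P h) (hq : ∀ y, q y ≤ Q * h y) (hQ : 0 ≤ Q) (hκ : gapKappa P h ≤ κ)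
    (hκ0 : 0 ≤ κ)
    (hκ1 : κ < 1) (hM₁ : ratioSq φ θ h ≤ M₁) (hM₂ : ratioMax φ θ h ≤ M₂) (hn : 1 ≤ n) (hm : 1 ≤ m)
    (hp : 1 ≤ p) (hK : 0 < K) (hφ : ∀ y j, |φ y j| ≤ K) {τ : ℝ} (hτ : 0 ≤ τ)
    (hbG : noiseLevel K κ M₁ τ * √(Real.log p / m) * ((1 + 2 * K + 4 * K ^ 2) * (M₂ + 1)) ≤
      2 * chainVar K κ M₁ * ((1 - κ) / 4)) :
    μ.real {ω | ¬ IsAccurate φ θ h m (fun i => x i ω) (fun i => Y i ω)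
      (noiseLevel K κ M₁ τ * √(Real.log p / n)) (noiseLevel K κ M₁ τ * √(Real.log p / m))} ≤
      (2 + 6 * Q) * Real.exp ((2 - τ) * Real.log p) := by
  have hC := chainVar_pos K M₁ hκ1
  have hp1 : (1 : ℝ) ≤ p := by exact_mod_cast hp
  have hlog : 0 ≤ Real.log p := Real.log_nonneg hp1
  have hA : 0 ≤ noiseLevel K κ M₁ τ := Real.sqrt_nonneg _
  have hA2 : noiseLevel K κ M₁ τ ^ 2 = τ * (2 * K ^ 2 + 4 * chainVar K κ M₁) :=
    Real.sq_sqrt (by positivity)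
  refine (measureReal_not_isAccurate_le hx hY hP hq hκ hκ0 hκ1 hM₁ hM₂ hn hm hK hφ
    (by positivity) (by positivity) hbG).trans ?_
  have sq_eq {N : ℕ} (hN : 1 ≤ N) : N * (noiseLevel K κ M₁ τ * √(Real.log p / N)) ^ 2 =
      τ * (2 * K ^ 2 + 4 * chainVar K κ M₁) * Real.log p := by
    have hN0 : (0 : ℝ) < N := by exact_mod_cast hN
    rw [mul_pow, hA2, Real.sq_sqrt (by positivity)]
    field_simp
  rw [sq_eq hn, sq_eq hm]
  set e := Real.exp (-(τ * Real.log p)) with he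
  have hτl : 0 ≤ τ * Real.log p := mul_nonneg hτ hlog
  have e1 : Real.exp (-(τ * (2 * K ^ 2 + 4 * chainVar K κ M₁) * Real.log p / (2 * K ^ 2))) ≤ e := by
    rw [he, Real.exp_le_exp, neg_le_neg_iff, le_div_iff₀ (by positivity)]
    nlinarith [mul_nonneg hτl hC.le]
  have e2 : Real.exp (-(τ * (2 * K ^ 2 + 4 * chainVar K κ M₁) * Real.log p /
      (4 * chainVar K κ M₁))) ≤ e := by
    rw [he, Real.exp_le_exp, neg_le_neg_iff, le_div_iff₀ (by positivity)]
    nlinarith [mul_nonneg hτl (sq_nonneg K)]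
  have e3 : Real.exp ((2 - τ) * Real.log p) = (p : ℝ) ^ 2 * e := by
    rw [sub_mul, sub_eq_add_neg, Real.exp_add, two_mul, Real.exp_add, Real.exp_log (by linarith)]
    ring
  rw [e3]
  have he0 : 0 < e := Real.exp_pos _
  have hpp : (p : ℝ) ≤ (p : ℝ) ^ 2 := by nlinarith
  calc _ ≤ p * (2 * e) + (1 + p + (p : ℝ) ^ 2) * (2 * Q * e) := by gcongr
    _ ≤ (p : ℝ) ^ 2 * (2 * e) + ((p : ℝ) ^ 2 + (p : ℝ) ^ 2 + (p : ℝ) ^ 2) * (2 * Q * e) := by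
        gcongr
        linarith
    _ = _ := by ring

end Accuracy

/-! ### Asymptotics -/

lemma IsBigOp.isLittleOp_one {Ω : ℕ → Type*} [∀ n, MeasurableSpace (Ω n)]
    {μ : ∀ n, Measure (Ω n)} {X : ∀ n, Ω n → ℝ} {a : ℕ → ℝ} (hX : IsBigOp μ X a)
    (ha : Tendsto a atTop (𝓝 0)) : IsLittleOp μ X fun _ => 1 := by
  intro ε hε
  rw [ENNReal.tendsto_nhds_zero]
  intro δ hδ
  rcases eq_or_ne δ ⊤ with rfl | hδt
  · exact Eventually.of_forall fun _ => le_top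
  obtain ⟨M, hM⟩ := hX δ.toReal (ENNReal.toReal_pos hδ.ne' hδt)
  have h1 : Tendsto (fun n => M * |a n|) atTop (𝓝 0) := by
    simpa using ha.abs.const_mul M
  filter_upwards [h1.eventually (gt_mem_nhds hε), eventually_ge_atTop 1] with n hn hn1
  refine (measure_mono ?_).trans ((hM n hn1).trans (ENNReal.ofReal_toReal hδt).le)
  intro ω hω
  simp only [Set.mem_ofPred_eq, abs_one, mul_one] at hω ⊢
  linarith

section Rate

variable {n m p : ℕ}

lemma rate_nonneg (n m p : ℕ) : 0 ≤ rate n m p := by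
  have := Real.log_natCast_nonneg p
  unfold rate
  positivity

lemma sqrt_log_div_add_le_rate (n m p : ℕ) :
    √(Real.log p / n) + √(Real.log p / m) ≤ rate n m p := by
  have h1 : 0 ≤ Real.log p / m := div_nonneg (Real.log_natCast_nonneg p) (Nat.cast_nonneg m)
  rw [rate]
  linarith

lemma two_le_of_rate_pos (h : 0 < rate n m p) : 2 ≤ p := by
  by_contra! hp
  have : p = 0 ∨ p = 1 := by omega
  rcases this with rfl | rfl <;> simp [rate] at h

end Rate

/-- The event that the estimator is far from the target has small probability, for fixed `n`. -/
lemma measure_l1Norm_sub_gt_le {Ω : Type*} [MeasurableSpace Ω] {μ : Measure Ω}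
    [IsProbabilityMeasure μ] {d r p n m : ℕ} {φ : Config d r → Fin p → ℝ} {θ : Fin p → ℝ}
    {x : Fin n → Ω → Config d r} {q h : Config d r → ℝ} {P : Config d r → Config d r → ℝ}
    {Y : ℕ → Ω → Config d r} {K κ M₁ M₂ Q B Cmin lam1 lam2 τ c E R : ℝ} {N : ℕ}
    {θhat : Ω → Fin p → ℝ}
    (hx : IsIIDSample μ φ θ x) (hY : IsMarkovChain μ q P Y) (hP : IsStationaryKernel P h)
    (hq : ∀ y, q y ≤ Q * h y) (hQ : 0 ≤ Q) (hκ : gapKappa P h ≤ κ) (hκ0 : 0 ≤ κ) (hκ1 : κ < 1)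
    (hM₁ : ratioSq φ θ h ≤ M₁) (hM₂ : ratioMax φ θ h ≤ M₂) (hn : 1 ≤ n) (hm : 1 ≤ m)
    (hp : 1 ≤ p) (hK : 0 < K) (hφ : ∀ y j, |φ y j| ≤ K) (hB : ∀ j, |θ j| ≤ B) (hCmin : 0 < Cmin)
    (hcomp : (Cmin : EReal) ≤ ⨅ T : Finset (Fin p), ⨅ ζ : ℝ, ⨅ _ : 1 < ζ,
      compatFactor ζ T (covStat φ θ))
    (hs : 1 ≤ l0Norm θ) (h1 : 0 < lam1) (h2 : 0 ≤ lam2)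
    (hθ : ∀ ω, IsPenalizedMLE φ h m (fun i => x i ω) (fun i => Y i ω) lam1 lam2 (θhat ω))
    (hτ : 0 ≤ τ) (hN : 1 ≤ N)
    (hcase : 2 * noiseLevel K κ M₁ τ * rate n m p ≤ lam1 / 2 ∨ p ≤ N)
    (hE0 : 0 ≤ E)
    (hE : 2 * noiseLevel K κ M₁ τ * rate n m p + 5 / 4 * lam1 + 2 * lam2 * B ≤ lam1 * E)
    (hR : 8 * E * (1 + 4 * E) / Cmin * (N * l0Norm θ) * lam1 < R) (hKR : 4 * K * R ≤ 1)
    (hc : c * rate n m p ≤ lam1) (hRc : 36 * noiseLevel K κ M₁ τ * R ≤ c)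
    (hb : noiseLevel K κ M₁ τ * rate n m p ≤ 1 / 2)
    (hG : noiseLevel K κ M₁ τ * rate n m p * ((1 + 2 * K + 4 * K ^ 2) * (|M₂| + 1)) ≤
      2 * chainVar K κ M₁ * ((1 - κ) / 4)) :
    μ {ω | R < l1Norm (θhat ω - θ)} ≤
      ENNReal.ofReal ((2 + 6 * Q) * Real.exp ((2 - τ) * Real.log p)) := by
  set A := noiseLevel K κ M₁ τ with hA
  have hA0 : 0 ≤ A := Real.sqrt_nonneg _
  have hr0 := rate_nonneg n m p
  have hsum := sqrt_log_div_add_le_rate n m p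
  have hsn : 0 ≤ √(Real.log p / n) := Real.sqrt_nonneg _
  have hsm : 0 ≤ √(Real.log p / m) := Real.sqrt_nonneg _
  have hbr : A * √(Real.log p / m) ≤ A * rate n m p :=
    mul_le_mul_of_nonneg_left (by linarith) hA0
  have hab : A * √(Real.log p / n) + 2 * (A * √(Real.log p / m)) ≤ 2 * A * rate n m p := by
    have := mul_le_mul_of_nonneg_left hsum hA0
    have := mul_nonneg hA0 hsn
    linarith
  have hRpos : 0 < R := lt_of_le_of_lt (by positivity) hR
  have hprob := measureReal_not_isAccurate_noiseLevel_le hx hY hP hq hQ hκ hκ0 hκ1 hM₁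
    (hM₂.trans (le_abs_self _)) hn hm hp hK hφ hτ
    ((mul_le_mul_of_nonneg_right hbr (by positivity)).trans hG)
  rw [← hA] at hprob
  -- Monotonicity of the outer measure suffices, so `θhat` need not be measurable.
  refine le_trans (measure_mono fun ω hω => ?_)
    ((ENNReal.le_ofReal_iff_toReal_le (measure_ne_top _ _)
      (measureReal_nonneg.trans hprob)).2 hprob)
  intro hacc
  have hω : R < l1Norm (θhat ω - θ) := hω
  refine hω.not_gt ?_
  have hbR : 36 * (A * √(Real.log p / m)) * R ≤ lam1 := by
    calc 36 * (A * √(Real.log p / m)) * R ≤ 36 * (A * rate n m p) * R := by gcongr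
      _ = 36 * A * R * rate n m p := by ring
      _ ≤ c * rate n m p := mul_le_mul_of_nonneg_right hRc hr0
      _ ≤ lam1 := hc
  have hRT {T : Finset (Fin p)} (hT : T.card ≤ N * l0Norm θ) :
      8 * E * (1 + 4 * E) / Cmin * T.card * lam1 < R := by
    refine lt_of_le_of_lt ?_ hR
    have : (T.card : ℝ) ≤ N * l0Norm θ := by exact_mod_cast hT
    gcongr
  have main {T : Finset (Fin p)} (hT : ∀ j ∉ T, θ j = 0)
      (hTz : A * √(Real.log p / n) + 2 * (A * √(Real.log p / m)) ≤ lam1 / 2 ∨ T = Finset.univ)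
      (hTc : T.card ≤ N * l0Norm θ) : l1Norm (θhat ω - θ) < R :=
    hacc.l1Norm_sub_lt (hθ ω) hP.pos hm h1 h2 (hbr.trans hb) hφ hB hCmin hcomp hT hTz
      (by linarith) hE0 (hRT hTc) hKR hbR
  rcases hcase with H | H
  · refine main (T := Finset.univ.filter fun j => θ j ≠ 0) (fun j hj => by simpa using hj)
      (Or.inl (hab.trans H)) ?_
    exact Nat.le_mul_of_pos_left _ hN
  · refine main (T := Finset.univ) (fun j hj => absurd (Finset.mem_univ j) hj) (Or.inr rfl) ?_
    rw [Finset.card_univ, Fintype.card_fin]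
    exact H.trans (Nat.le_mul_of_pos_right _ hs)

end SimMRF

/-! ### Choice of constants and the split by dimension. -/

theorem mainTheorem4 (K κ M₁ : ℝ) (hK : 0 < K) (hκ : κ < 1) :
    ∃ A₀ : ℝ, 0 < A₀ ∧
      ∀ (M₂ Q B Cmin : ℝ) (S : ℕ), 0 < B → 0 < Cmin →
      ∀ (Ω : ℕ → Type*) [∀ n, MeasurableSpace (Ω n)]
        (μ : ∀ n, Measure (Ω n)) [∀ n, IsProbabilityMeasure (μ n)]
        -- dimensions and Monte Carlo sample sizes
        (d r p m : ℕ → ℕ)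
        -- model and true parameter
        (φ : ∀ n, Config (d n) (r n) → Fin (p n) → ℝ)
        (θs : ∀ n, Fin (p n) → ℝ)
        -- transition kernel, initial distribution, stationary distribution
        (P : ∀ n, Config (d n) (r n) → Config (d n) (r n) → ℝ)
        (q h : ∀ n, Config (d n) (r n) → ℝ)
        -- the data, the simulated chain, the tuning parameters and the estimator
        (x : ∀ n, Fin n → Ω n → Config (d n) (r n))
        (Y : ∀ n, ℕ → Ω n → Config (d n) (r n))
        (lam1 lam2 : ℕ → ℝ)
        (θhat : ∀ n, Ω n → Fin (p n) → ℝ),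
      (∀ n ≥ 1, 1 ≤ m n) →
      (∀ n ≥ 1, SimMRF.IsIIDSample (μ n) (φ n) (θs n) (x n)) →
      (∀ n ≥ 1, SimMRF.IsStationaryKernel (P n) (h n)) →
      (∀ n ≥ 1, SimMRF.IsMarkovChain (μ n) (q n) (P n) (Y n)) →
      -- quality of the simulated chain
      (∀ n ≥ 1, ∀ y, q n y ≤ Q * h n y) →
      (∀ n ≥ 1, SimMRF.gapKappa (P n) (h n) ≤ κ) →
      (∀ n ≥ 1, SimMRF.ratioSq (φ n) (θs n) (h n) ≤ M₁) →
      (∀ n ≥ 1, SimMRF.ratioMax (φ n) (θs n) (h n) ≤ M₂) →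
      -- bounded statistics, compatibility condition, bounded true parameter
      (∀ n ≥ 1, ∀ y j, |φ n y j| ≤ K) →
      (∀ n ≥ 1, (Cmin : EReal) ≤ ⨅ T : Finset (Fin (p n)), ⨅ ζ : ℝ, ⨅ _ : 1 < ζ,
        SimMRF.compatFactor ζ T (SimMRF.covStat (φ n) (θs n))) →
      (∀ n ≥ 1, ∀ j, |θs n j| ≤ B) →
      -- sparsity
      (∀ n ≥ 1, 1 ≤ SimMRF.l0Norm (θs n) ∧ SimMRF.l0Norm (θs n) ≤ S) →
      -- tuning parameters
      (∀ n ≥ 1, 0 < lam1 n ∧ 0 < lam2 n) →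
      SimMRF.SameOrder lam1 (fun n => SimMRF.rate n (m n) (p n)) →
      ((∀ᶠ n in atTop, A₀ * SimMRF.rate n (m n) (p n) ≤ lam1 n) ∨ ∃ N, ∀ n ≥ 1, p n ≤ N) →
      SimMRF.SameOrder lam1 lam2 →
      Tendsto lam1 atTop (𝓝 0) →
      -- the estimator
      (∀ n ≥ 1, ∀ ω, SimMRF.IsPenalizedMLE (φ n) (h n) (m n) (fun i => x n i ω)
        (fun i => Y n i ω) (lam1 n) (lam2 n) (θhat n ω)) →
      SimMRF.IsBigOp μ (fun n ω => SimMRF.l1Norm (θhat n ω - θs n))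
          (fun n => (SimMRF.l0Norm (θs n) : ℝ) * SimMRF.rate n (m n) (p n)) ∧
        SimMRF.IsLittleOp μ (fun n ω => SimMRF.l1Norm (θhat n ω - θs n)) (fun _ => 1) := by
  set κ' := max κ 0 with hκ'
  have hκ0 : 0 ≤ κ' := le_max_right _ _
  have hκ1 : κ' < 1 := max_lt hκ one_pos
  -- The factor `4` yields `2 A ρ ≤ λ₁/2` at `τ = 3`; the `+ 1` ensures positivity.
  refine ⟨4 * SimMRF.noiseLevel K κ' M₁ 3 + 1, ?_, ?_⟩
  · have : 0 ≤ SimMRF.noiseLevel K κ' M₁ 3 := Real.sqrt_nonneg _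
    linarith
  intro M₂ Q₀ B Cmin S hB0 hCmin Ω _ μ _ d r p m φ θs P q h x Y lam1 lam2 θhat hm hx hP hY hq₀ hgap₀
    hM₁ hM₂ hφ hcomp hB hs hlam hrate hA₀ hlam12 hlam0 hθ
  obtain ⟨⟨C₁, hC₁, hC₁r⟩, ⟨c₁, hc₁, hc₁r⟩⟩ := hrate
  obtain ⟨-, ⟨c₂, hc₂, hc₂r⟩⟩ := hlam12
  set Q := max Q₀ 0 with hQ
  have hQ0 : 0 ≤ Q := le_max_right _ _
  have hq : ∀ n ≥ 1, ∀ y, q n y ≤ Q * h n y := fun n hn y => (hq₀ n hn y).trans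
    (mul_le_mul_of_nonneg_right (le_max_left _ _) ((hP n hn).pos y).le)
  have hgap : ∀ n ≥ 1, SimMRF.gapKappa (P n) (h n) ≤ κ' := fun n hn =>
    (hgap₀ n hn).trans (le_max_left _ _)
  set ρ : ℕ → ℝ := fun n => SimMRF.rate n (m n) (p n) with hρ
  have hρ0 (n) : 0 ≤ ρ n := SimMRF.rate_nonneg _ _ _
  have hρpos : ∀ n ≥ 1, 0 < ρ n := fun n hn =>
    pos_of_mul_pos_right ((hlam n hn).1.trans_le (hC₁r n hn)) hC₁.le
  have hp2 : ∀ n ≥ 1, 2 ≤ p n := fun n hn => SimMRF.two_le_of_rate_pos (hρpos n hn)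
  have hρlim : Tendsto ρ atTop (𝓝 0) := by
    have h1 : Tendsto (fun n => c₁⁻¹ * lam1 n) atTop (𝓝 0) := by simpa using hlam0.const_mul c₁⁻¹
    refine tendsto_of_tendsto_of_tendsto_of_le_of_le' tendsto_const_nhds h1
      (Eventually.of_forall hρ0) ?_
    filter_upwards [eventually_ge_atTop 1] with n hn
    rw [← div_eq_inv_mul, le_div_iff₀ hc₁, mul_comm]
    exact hc₁r n hn
  have hsmall (c : ℝ) {t : ℝ} (ht : 0 < t) : ∀ᶠ n in atTop, c * ρ n ≤ t := by
    have h1 : Tendsto (fun n => c * ρ n) atTop (𝓝 0) := by simpa using hρlim.const_mul c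
    filter_upwards [h1.eventually (gt_mem_nhds ht)] with n hn using hn.le
  have hlim : Tendsto (fun n => (SimMRF.l0Norm (θs n) : ℝ) * ρ n) atTop (𝓝 0) := by
    have h1 : Tendsto (fun n => (S : ℝ) * ρ n) atTop (𝓝 0) := by simpa using hρlim.const_mul (S : ℝ)
    refine tendsto_of_tendsto_of_tendsto_of_le_of_le' tendsto_const_nhds h1
      (Eventually.of_forall fun n => mul_nonneg (Nat.cast_nonneg _) (hρ0 n)) ?_
    filter_upwards [eventually_ge_atTop 1] with n hn
    exact mul_le_mul_of_nonneg_right (by exact_mod_cast (hs n hn).2) (hρ0 n)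
  have hapos : ∀ n ≥ 1, 0 < (SimMRF.l0Norm (θs n) : ℝ) * ρ n := fun n hn =>
    mul_pos (by exact_mod_cast (hs n hn).1) (hρpos n hn)
  have hbig : SimMRF.IsBigOp μ (fun n ω => SimMRF.l1Norm (θhat n ω - θs n))
      (fun n => (SimMRF.l0Norm (θs n) : ℝ) * ρ n) := by
    intro ε hε
    -- the threshold `N` that separates small from large dimensions
    obtain ⟨N, hN1, hNε, hNp⟩ : ∃ N : ℕ, 1 ≤ N ∧ (2 + 6 * Q) / N ≤ ε ∧
        ((∀ᶠ n in atTop, (4 * SimMRF.noiseLevel K κ' M₁ 3 + 1) * ρ n ≤ lam1 n) ∨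
          ∀ n ≥ 1, p n ≤ N) := by
      obtain ⟨N₀, hN₀⟩ := exists_nat_gt ((2 + 6 * Q) / ε)
      have hgood {N : ℕ} (hN : N₀ ≤ N) (hN1 : 1 ≤ N) : (2 + 6 * Q) / N ≤ ε := by
        have h1 : (N₀ : ℝ) ≤ N := by exact_mod_cast hN
        have h2 : (0 : ℝ) < N := by exact_mod_cast hN1
        rw [div_le_iff₀ h2]
        rw [div_lt_iff₀ hε] at hN₀
        nlinarith
      rcases hA₀ with H | ⟨N₁, hN₁⟩
      · exact ⟨N₀ + 1, by omega, hgood (by omega) (by omega), Or.inl H⟩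
      · exact ⟨N₀ + N₁ + 1, by omega, hgood (by omega) (by omega),
          Or.inr fun n hn => (hN₁ n hn).trans (by omega)⟩
    obtain ⟨k, hk⟩ : ∃ k : ℕ, (1 / 2 : ℝ) ^ k < ε / (2 + 6 * Q) :=
      exists_pow_lt_of_lt_one (by positivity) (by norm_num)
    -- the constants of the oracle inequality
    set E : ℝ → ℝ := fun τ => 2 * SimMRF.noiseLevel K κ' M₁ τ / c₁ + 5 / 4 + 2 * B / c₂ with hE
    have hE0 (τ) : 0 ≤ E τ := by
      have : 0 ≤ SimMRF.noiseLevel K κ' M₁ τ := Real.sqrt_nonneg _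
      simp only [hE]; positivity
    -- The summand `1` makes the radius strictly larger than the oracle bound.
    set L : ℝ → ℝ := fun τ => 8 * E τ * (1 + 4 * E τ) / Cmin * N * C₁ + 1 with hL
    have hL0 (τ) : 0 < L τ := by
      have := hE0 τ
      simp only [hL]; positivity
    have key (τ : ℝ) (hτ : 0 ≤ τ) : ∀ᶠ n in atTop,
        (2 * SimMRF.noiseLevel K κ' M₁ τ * ρ n ≤ lam1 n / 2 ∨ p n ≤ N) →
        μ n {ω | L τ * (SimMRF.l0Norm (θs n) * ρ n) < SimMRF.l1Norm (θhat n ω - θs n)} ≤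
          ENNReal.ofReal ((2 + 6 * Q) * Real.exp ((2 - τ) * Real.log (p n))) := by
      have hA0 : 0 ≤ SimMRF.noiseLevel K κ' M₁ τ := Real.sqrt_nonneg _
      have hC := SimMRF.chainVar_pos K M₁ hκ1
      filter_upwards [eventually_ge_atTop 1,
        hsmall (4 * K * L τ * S) one_pos,
        hsmall (36 * SimMRF.noiseLevel K κ' M₁ τ * L τ * S) hc₁,
        hsmall (SimMRF.noiseLevel K κ' M₁ τ) (by norm_num : (0 : ℝ) < 1 / 2),
        hsmall (SimMRF.noiseLevel K κ' M₁ τ * ((1 + 2 * K + 4 * K ^ 2) * (|M₂| + 1)))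
          (t := 2 * SimMRF.chainVar K κ' M₁ * ((1 - κ') / 4))
          (mul_pos (by positivity) (by linarith))] with n hn e1 e2 e3 e4 hcase
      have hl1 := (hlam n hn).1
      have hs1 : (1 : ℝ) ≤ SimMRF.l0Norm (θs n) := by exact_mod_cast (hs n hn).1
      have hsS : (SimMRF.l0Norm (θs n) : ℝ) ≤ S := by exact_mod_cast (hs n hn).2
      have hsρ : SimMRF.l0Norm (θs n) * ρ n ≤ S * ρ n := mul_le_mul_of_nonneg_right hsS (hρ0 n)
      have hLpos := hL0 τ
      refine SimMRF.measure_l1Norm_sub_gt_le (N := N) (E := E τ) (c := c₁) (hx n hn) (hY n hn)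
        (hP n hn) (hq n hn) hQ0 (hgap n hn) hκ0 hκ1 (hM₁ n hn) (hM₂ n hn) hn (hm n hn)
        (by have := hp2 n hn; omega) hK (hφ n hn) (hB n hn) hCmin (hcomp n hn) (hs n hn).1 hl1
        (hlam n hn).2.le (hθ n hn) hτ hN1 hcase (hE0 τ) ?_ ?_ ?_ (hc₁r n hn) ?_ e3 ?_
      · have f1 : 2 * SimMRF.noiseLevel K κ' M₁ τ * ρ n ≤
            lam1 n * (2 * SimMRF.noiseLevel K κ' M₁ τ / c₁) := by
          rw [mul_div_assoc', le_div_iff₀ hc₁]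
          have := mul_le_mul_of_nonneg_left (hc₁r n hn) hA0
          simp only [hρ]
          linarith
        have f2 : 2 * lam2 n * B ≤ lam1 n * (2 * B / c₂) := by
          rw [mul_div_assoc', le_div_iff₀ hc₂]
          have := mul_le_mul_of_nonneg_left (hc₂r n hn) hB0.le
          linarith
        change 2 * SimMRF.noiseLevel K κ' M₁ τ * ρ n + _ + _ ≤ _
        simp only [hE]
        linarith
      · have f0 : 0 ≤ 8 * E τ * (1 + 4 * E τ) / Cmin * (N * SimMRF.l0Norm (θs n)) := by
          have := hE0 τ
          positivity
        have f1 := mul_le_mul_of_nonneg_left (hC₁r n hn) f0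
        refine f1.trans_lt ?_
        have f2 := hapos n hn
        simp only [hL]
        have f3 : 8 * E τ * (1 + 4 * E τ) / Cmin * (N * SimMRF.l0Norm (θs n)) *
            (C₁ * SimMRF.rate n (m n) (p n)) =
            8 * E τ * (1 + 4 * E τ) / Cmin * N * C₁ * (SimMRF.l0Norm (θs n) * ρ n) := by
          simp only [hρ]; ring
        rw [f3]
        linarith
      · calc 4 * K * (L τ * (SimMRF.l0Norm (θs n) * ρ n)) ≤ 4 * K * (L τ * (S * ρ n)) := by gcongr
          _ = 4 * K * L τ * S * ρ n := by ring
          _ ≤ 1 := e1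
      · calc 36 * SimMRF.noiseLevel K κ' M₁ τ * (L τ * (SimMRF.l0Norm (θs n) * ρ n))
            ≤ 36 * SimMRF.noiseLevel K κ' M₁ τ * (L τ * (S * ρ n)) := by gcongr
          _ = 36 * SimMRF.noiseLevel K κ' M₁ τ * L τ * S * ρ n := by ring
          _ ≤ c₁ := e2
      · rwa [mul_right_comm]
    set M := max (L 3) (L (2 + k)) with hM
    have hev : ∀ᶠ n in atTop,
        μ n {ω | M * (SimMRF.l0Norm (θs n) * ρ n) < SimMRF.l1Norm (θhat n ω - θs n)} ≤
          ENNReal.ofReal ε := by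
      have hlarge : ∀ᶠ n in atTop,
          2 * SimMRF.noiseLevel K κ' M₁ 3 * ρ n ≤ lam1 n / 2 ∨ p n ≤ N := by
        rcases hNp with H | H
        · filter_upwards [H] with n hn
          left
          linarith [hρ0 n]
        · filter_upwards [eventually_ge_atTop 1] with n hn using Or.inr (H n hn)
      filter_upwards [eventually_ge_atTop 1, key 3 (by norm_num), key (2 + k) (by positivity),
        hlarge] with n hn k1 k2 hl
      have hp0 : (0 : ℝ) < p n := by
        have := hp2 n hn
        exact_mod_cast (by omega : 0 < p n)
      have hmono {τ : ℝ} (hτM : L τ ≤ M) :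
          μ n {ω | M * (SimMRF.l0Norm (θs n) * ρ n) < SimMRF.l1Norm (θhat n ω - θs n)} ≤
          μ n {ω | L τ * (SimMRF.l0Norm (θs n) * ρ n) < SimMRF.l1Norm (θhat n ω - θs n)} :=
        measure_mono fun ω hω =>
          (mul_le_mul_of_nonneg_right hτM (hapos n hn).le).trans_lt hω
      -- For `p ≤ N`, `τ = 2 + k` gives `p ^ (-k) ≤ 2 ^ (-k)` since `p ≥ 2`. For `p > N`, `τ = 3`
      -- gives `1/p < 1/N`.
      rcases le_or_gt (p n) N with hpN | hpN
      · refine (hmono (le_max_right _ _)).trans ((k2 (Or.inr hpN)).trans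
          (ENNReal.ofReal_le_ofReal ?_))
        have f1 : Real.exp ((2 - (2 + (k : ℝ))) * Real.log (p n)) ≤ (1 / 2 : ℝ) ^ k := by
          have f2 : (2 - (2 + (k : ℝ))) * Real.log (p n) = k * -Real.log (p n) := by ring
          rw [f2, Real.exp_nat_mul, Real.exp_neg, Real.exp_log hp0, ← one_div]
          refine pow_le_pow_left₀ (by positivity) ?_ _
          exact one_div_le_one_div_of_le two_pos (by exact_mod_cast hp2 n hn)
        have f3 := f1.trans hk.le
        rwa [le_div_iff₀ (by positivity), mul_comm] at f3
      · refine (hmono (le_max_left _ _)).trans ((k1 hl).trans (ENNReal.ofReal_le_ofReal ?_))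
        have f2 : (2 - 3 : ℝ) * Real.log (p n) = -Real.log (p n) := by ring
        rw [f2, Real.exp_neg, Real.exp_log hp0, ← div_eq_mul_inv]
        refine le_trans ?_ hNε
        have : (N : ℝ) ≤ p n := by exact_mod_cast hpN.le
        have : (0 : ℝ) < N := by exact_mod_cast hN1
        gcongr
    -- finitely many remaining `n`, where the estimator is bounded
    obtain ⟨n₀, hn₀⟩ := eventually_atTop.1 hev
    have hbd (n : ℕ) : ∃ D : ℝ, n ≥ 1 → ∀ ω, SimMRF.l1Norm (θhat n ω - θs n) ≤ D := by
      by_cases hn : n ≥ 1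
      · obtain ⟨D, hD⟩ := SimMRF.IsPenalizedMLE.exists_bound (φ := φ n) (hP n hn).pos
          (hP n hn).sum_eq_one (hm n hn) hn (hφ n hn) (hlam n hn).1.le (hlam n hn).2
        refine ⟨D + SimMRF.l1Norm (θs n), fun _ ω => ?_⟩
        have f1 := hD _ _ _ (hθ n hn ω)
        have f2 : SimMRF.l1Norm (θhat n ω - θs n) ≤
            SimMRF.l1Norm (θhat n ω) + SimMRF.l1Norm (θs n) := by
          simp only [SimMRF.l1Norm, ← Finset.sum_add_distrib]
          exact Finset.sum_le_sum fun j _ => abs_sub _ _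
        linarith
      · exact ⟨0, fun hn' => absurd hn' hn⟩
    choose D hD using hbd
    -- The extra sum dominates the ratio of the deterministic bound to the rate for every `n < n₀`,
    -- making the exceptional sets empty there.
    set M' := M + ∑ n ∈ Finset.range n₀, |D n / (SimMRF.l0Norm (θs n) * ρ n)| with hM'
    refine ⟨M', fun n hn => ?_⟩
    have ha := hapos n hn
    have habs : |SimMRF.l0Norm (θs n) * ρ n| = SimMRF.l0Norm (θs n) * ρ n := abs_of_pos ha
    have hMM' : M ≤ M' := by
      rw [hM']
      linarith [Finset.sum_nonneg fun n (_ : n ∈ Finset.range n₀) =>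
        abs_nonneg (D n / (SimMRF.l0Norm (θs n) * ρ n))]
    simp only [habs, abs_of_nonneg (SimMRF.l1Norm_nonneg _)]
    rcases lt_or_ge n n₀ with hlt | hge
    · have hM0 : 0 ≤ M := (hL0 3).le.trans (le_max_left _ _)
      have f1 : D n / (SimMRF.l0Norm (θs n) * ρ n) ≤ M' := by
        have := Finset.single_le_sum (f := fun n => |D n / (SimMRF.l0Norm (θs n) * ρ n)|)
          (fun n _ => abs_nonneg _) (Finset.mem_range.2 hlt)
        have := le_abs_self (D n / (SimMRF.l0Norm (θs n) * ρ n))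
        linarith
      rw [div_le_iff₀ ha] at f1
      have f2 : {ω | M' * (SimMRF.l0Norm (θs n) * ρ n) < SimMRF.l1Norm (θhat n ω - θs n)} = ∅ := by
        ext ω
        simp only [Set.mem_ofPred_eq, Set.mem_empty_iff_false, iff_false, not_lt]
        exact (hD n hn ω).trans f1
      rw [f2, measure_empty]
      exact zero_le
    · refine (measure_mono fun ω hω => ?_).trans (hn₀ n hge)
      exact (mul_le_mul_of_nonneg_right hMM' ha.le).trans_lt hω
  exact ⟨hbig, hbig.isLittleOp_one hlim⟩
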